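/- Let $\mathbb{C}^+=\{z:\operatorname{Im} z>0\}$ and let $\mathcal{H}$ be the set of analytic functions $f:\mathbb{C}^+\to\{w\in\mathbb{C}:\operatorname{Im} w\ge 0\}$. Every $f\in\mathcal{H}$ has a unique Nevanlinna representation $$f(z)=\alpha z+\beta+\int_{\mathbb{R}}\frac{1+zt}{t-z}\,d\rho(t),\qquad z\in\mathbb{C}^+,$$ with $\alpha\ge 0$, $\beta\in\mathbb{R}$ and $\rho$ a finite positive Borel measure on $\mathbb{R}$. Let $\sigma(f)\subset\mathbb{R}\cup\{\infty\}$ be the closed support of $\rho$, with $\infty$ added if $\alpha>0$ or the support is unbounded; let $\Omega(f)=(\mathbb{R}\cup\{\infty\})\setminus\sigma(f)$, on which the formula extends $f$ analytically with real values (at $\infty$ by the limit value $\beta-\int t\,d\rho(t)$); and let $\Gamma(f)=\{x\in\Omega(f): f(x)<0\}$. For $b,a\in\mathbb{R}\cup\{\infty\}$ let $(b,a)$ be the open arc of the circle $\mathbb{R}\cup\{\infty\}$ from $b$ to $a$ in the increasing direction; thus $(\infty,a)=(-\infty,a)$, $(b,a)=(b,\infty)\cup\{\infty\}\cup(-\infty,a)$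 for real $b>a$, and $(b,b)$ is the circle without $b$. Put $$p_{(b,a)}(z)=\frac{|i-b|}{|i-a|}\cdot\frac{z-a}{z-b}\quad(b<a\text{ real}),\qquad p_{(-\infty,a)}(z)=\frac{z-a}{|i-a|},$$ put $p_J=-1/p_{J'}$ if $J$ is the complement of the closure of an interval $J'$ of one of these two kinds, and put $p_J=-1$ if $J$ is the whole circle or the circle without one point. For an open set $O\subset\mathbb{R}\cup\{\infty\}$ with connected components $J_n$, $0\le n<N\le\infty$, the Kreĭn product of $O$ is $k_O(z)=\prod_{0\le n<N}p_{J_n}(z)$ (equal to $1$ if $O=\varnothing$). **Theorem.** Let $f\in\mathcal{H}$ be not identically zero, and assume that $\sigma(f)\cap\mathbb{R}$ has Lebesgue measure zero. Then $\Gamma(f)$ is open, the product defining $k_{\Gamma(f)}$ converges locally uniformly on $\mathbb{C}^+$, regardless of the order of its factors, and there is a constant $c>0$ such that $f=c\,k_{\Gamma(f)}$ on $\mathbb{C}^+$. -/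

import Mathlib

open scoped OnePoint

/-- The open upper half-plane `ℂ⁺`, as a subset of `ℂ`. -/
def upperHalf : Set ℂ := {z : ℂ | 0 < z.im}

/-- The class `𝓗` of analytic functions from `ℂ⁺` to the closed upper half-plane
`{w : 0 ≤ Im w}`. Functions are total on `ℂ`; their values off `ℂ⁺` play no role. -/
def ClassH (f : ℂ → ℂ) : Prop :=
  DifferentiableOn ℂ f upperHalf ∧ ∀ z ∈ upperHalf, 0 ≤ (f z).im

/-- The parameters of a Nevanlinna representation: `α ≥ 0`, `β ∈ ℝ`, and a finite positive Borel
measure `ρ` on `ℝ`. -/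
structure NevanlinnaData where
  α : ℝ
  β : ℝ
  ρ : MeasureTheory.Measure ℝ
  α_nonneg : 0 ≤ α
  finite : MeasureTheory.IsFiniteMeasure ρ

namespace NevanlinnaData

/-- `f(z) = α z + β + ∫ (1 + z t) / (t - z) dρ(t)` for all `z ∈ ℂ⁺`. -/
def Represents (D : NevanlinnaData) (f : ℂ → ℂ) : Prop :=
  ∀ z ∈ upperHalf,
    f z = (D.α : ℂ) * z + (D.β : ℂ) + ∫ t : ℝ, (1 + z * (t : ℂ)) / ((t : ℂ) - z) ∂D.ρ

/-- The closed support of `ρ`, to which `∞` is added if `α > 0` or the support is unbounded. -/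
def sigma (D : NevanlinnaData) : Set (OnePoint ℝ) :=
  ((↑) : ℝ → OnePoint ℝ) '' D.ρ.support ∪
    {x | x = ∞ ∧ (0 < D.α ∨ ¬ Bornology.IsBounded D.ρ.support)}

/-- The value that the right-hand side of the Nevanlinna formula takes at a point of
`ℝ ∪ {∞}` outside `sigma`; at `∞` (where then `α = 0` and the support of `ρ` is bounded) it is
`lim_{z → ∞} (β + ∫ (1 + z t) / (t - z) dρ(t)) = β - ∫ t dρ(t)`. -/
noncomputable def realValue (D : NevanlinnaData) : OnePoint ℝ → ℝ
  | ∞ => D.β - ∫ t : ℝ, t ∂D.ρ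
  | (x : ℝ) => D.α * x + D.β + ∫ t : ℝ, (1 + x * t) / (t - x) ∂D.ρ

end NevanlinnaData

open Classical in
/-- The parameters `α, β, ρ` of the Nevanlinna representation of `f` (they exist and are unique
for every `f` in the class `𝓗`; the zero parameters if there is no representation). -/
noncomputable def nevanlinnaData (f : ℂ → ℂ) : NevanlinnaData :=
  if h : ∃ D : NevanlinnaData, D.Represents f then h.choose
  else ⟨0, 0, 0, le_rfl, inferInstance⟩

/-- `σ(f)`. -/
noncomputable def sigmaSet (f : ℂ → ℂ) : Set (OnePoint ℝ) := (nevanlinnaData f).sigma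

/-- `Ω(f) = (ℝ ∪ {∞}) \ σ(f)`. -/
noncomputable def omegaSet (f : ℂ → ℂ) : Set (OnePoint ℝ) := (sigmaSet f)ᶜ

/-- `Γ(f) = {x ∈ Ω(f) : f(x) < 0}`, where `f` is extended to `Ω(f)` by its Nevanlinna formula. -/
noncomputable def gammaSet (f : ℂ → ℂ) : Set (OnePoint ℝ) :=
  {x | x ∈ omegaSet f ∧ (nevanlinnaData f).realValue x < 0}

/-- The open interval `(b, a)` of the circle `ℝ ∪ {∞}`: the points met when moving from `b` to `a`
in the increasing direction of `ℝ`. For real `b > a` this is `(b, ∞) ∪ {∞} ∪ (-∞, a)`;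
`(∞, a) = (-∞, a)`; and `(b, b)` is the circle without the point `b`. -/
noncomputable def circleInterval : OnePoint ℝ → OnePoint ℝ → Set (OnePoint ℝ)
  | ∞, ∞ => ((↑) : ℝ → OnePoint ℝ) '' Set.univ
  | ∞, (a : ℝ) => ((↑) : ℝ → OnePoint ℝ) '' Set.Iio a
  | (b : ℝ), ∞ => ((↑) : ℝ → OnePoint ℝ) '' Set.Ioi b
  | (b : ℝ), (a : ℝ) =>
      if b < a then ((↑) : ℝ → OnePoint ℝ) '' Set.Ioo b a
      else ((↑) : ℝ → OnePoint ℝ) '' Set.Ioi b ∪ {∞} ∪ ((↑) : ℝ → OnePoint ℝ) '' Set.Iio a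

/-- The factor `p_J` for the interval `J = (b, a)` of the circle: the conformal automorphism of
`ℂ⁺` that is negative precisely on `J` and has modulus `1` at `i`. The intervals containing `∞`
and the intervals `(b, ∞)` are complements of closures of intervals `J'` of the other two kinds,
and there `p_J = -1 / p_{J'}`. For the circle without one point the factor is `-1`, as for the
whole circle. -/
noncomputable def kreinFactor : OnePoint ℝ → OnePoint ℝ → ℂ → ℂ
  | ∞, ∞, _ => -1
  | ∞, (a : ℝ), z => (z - a) / (‖Complex.I - a‖ : ℂ)
  | (b : ℝ), ∞, z => -((‖Complex.I - b‖ : ℂ) / (z - b))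
  | (b : ℝ), (a : ℝ), z =>
      if b < a then ((‖Complex.I - b‖ : ℂ) / (‖Complex.I - a‖ : ℂ)) * ((z - a) / (z - b))
      else -(((‖Complex.I - b‖ : ℂ) / (‖Complex.I - a‖ : ℂ)) * ((z - a) / (z - b)))

/-- The pairs `(b, a)` such that the interval `(b, a)` is a connected component of `O`. If `O` is
open and not the whole circle, `O` is the disjoint union of these intervals. -/
def componentIntervals (O : Set (OnePoint ℝ)) : Set (OnePoint ℝ × OnePoint ℝ) :=
  {e | ∃ x ∈ O, connectedComponentIn O x = circleInterval e.1 e.2}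

open Classical in
/-- The Kreĭn product `k_O = ∏ p_J` over the components `J` of an open set `O ⊆ ℝ ∪ {∞}`
(`1` for `O = ∅`), with `k_O = -1` when `O` is the whole circle. -/
noncomputable def kreinProduct (O : Set (OnePoint ℝ)) (z : ℂ) : ℂ :=
  if O = Set.univ then -1
  else ∏' e : componentIntervals O, kreinFactor e.1.1 e.1.2 z

open MeasureTheory Filter Topology

/-! A nonvanishing function in the class has a logarithm whose imaginary part lies in `[0, π]`. By
the Schwarz formula such a logarithm is determined, up to an additive real constant, by the boundary
values of its imaginary part. Where the boundary values of `f` are real and nonzero, that imaginary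
part is `π` (where they are negative) or `0` (where they are positive). So `f = |f(i)| exp (π ∫_S (1
+ zt)/(t - z) dμ(t))`, with `S` the set of negativity and `μ` the harmonic measure at `i`; this is
`ClassH.eq_norm_mul_exp`.

The formula is used twice. For `f`, the support is null, so the boundary values are real almost
everywhere. They are almost everywhere nonzero because the extension increases strictly on each
interval free of `ρ`, unless `f` is a nonzero real constant. Hence `S` is the real part of `Γ(f)`.
For a factor `p_J`, which has modulus `1` at `i`, the set `S` is the real part of `J`. Since `Γ(f)`
is the disjoint union of its countably many components, additivity of the integral turns into
multiplicativity of the exponentials, and `c = |f(i)|`.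

Convergence in any order follows from `|p_J - 1| ≤ C μ(J)`, with `C` uniform on compact sets, and
from the finiteness of `μ`. The existence of a Nevanlinna representation is also proved, by weak
compactness, since `nevanlinnaData` has meaning only when one exists. Uniqueness is not needed: the
argument works for whichever data were chosen. -/

/-! ### The Schwarz integral formula in the disc. -/

/-- The function `-i G(r ·)` has real part `Im G(r ·)` and, because `r < 1`, is continuous up to the
unit circle. The Poisson formula shows that the kernel average has the same real part, so the two
differ by an imaginary constant. At `0`, where the kernel is `1`, this constant is `i Re G(0)`. -/
theorem schwarz_formula_disc {G : ℂ → ℂ} (hG : DifferentiableOn ℂ G (Metric.ball 0 1)) {r : ℝ}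
    (hr : r ∈ Set.Ico (0 : ℝ) 1) {z : ℂ} (hz : z ∈ Metric.ball (0 : ℂ) 1) :
    G (r * z) = (G 0).re + Complex.I * Real.circleAverage
      (fun ζ ↦ herglotzRieszKernel 0 z ζ • ((G (r * ζ)).im : ℂ)) 0 1 := by
  obtain ⟨hr0, hr1⟩ := hr
  set F : ℂ → ℂ := fun ζ ↦ -Complex.I * G (r * ζ) with hF
  have hmem : ∀ ζ ∈ Metric.closedBall (0 : ℂ) 1, (r : ℂ) * ζ ∈ Metric.ball (0 : ℂ) 1 := by
    intro ζ hζ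
    simp only [mem_closedBall_zero_iff, mem_ball_zero_iff, norm_mul, Complex.norm_real,
      Real.norm_eq_abs, abs_of_nonneg hr0] at hζ ⊢
    nlinarith [norm_nonneg ζ]
  have hFd : DifferentiableOn ℂ F (Metric.closedBall 0 1) :=
    (hG.comp (by fun_prop) hmem).const_mul _
  have hFcl : DiffContOnCl ℂ F (Metric.ball 0 1) := by
    refine DifferentiableOn.diffContOnCl ?_
    rwa [closure_ball (0 : ℂ) one_ne_zero]
  have hFre : ∀ ζ, (F ζ).re = (G (r * ζ)).im := fun ζ ↦ by simp [hF]
  set g : ℂ → ℝ := fun ζ ↦ (F ζ).re with hg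
  have hFs : ContinuousOn F (Metric.sphere 0 1) :=
    hFd.continuousOn.mono Metric.sphere_subset_closedBall
  have hgc : ContinuousOn g (Metric.sphere 0 1) := Complex.continuous_re.comp_continuousOn hFs
  have hgi : CircleIntegrable g 0 1 := hgc.circleIntegrable zero_le_one
  have hgi' : CircleIntegrable (fun ζ ↦ (g ζ : ℂ)) 0 1 :=
    (Complex.continuous_ofReal.comp_continuousOn hgc).circleIntegrable zero_le_one
  set H : ℂ → ℂ := fun w ↦ Real.circleAverage
      (fun ζ ↦ herglotzRieszKernel 0 w ζ • (g ζ : ℂ)) 0 1 with hH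
  have hHd : AnalyticOnNhd ℂ H (Metric.ball 0 1) :=
    analyticOnNhd_circleAverage_herglotzRieszKernel_smul hgi'
  have hre : ∀ w ∈ Metric.ball (0 : ℂ) 1, (H w).re = (F w).re := by
    intro w hw
    rw [hH]
    simp only
    rw [re_circleAverage_herglotzRieszKernel_smul hgi hw,
      ← hFcl.circleAverage_re_herglotzRieszKernel_smul hw]
    have hc : ContinuousOn ((Complex.re ∘ herglotzRieszKernel 0 w) • F) (Metric.sphere 0 1) := by
      refine ContinuousOn.smul (Complex.continuous_re.comp_continuousOn ?_) hFs
      simpa using continuousOn_herglotzRieszKernel_sphere hw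
    have := Complex.reCLM.circleAverage_comp_comm (hc.circleIntegrable zero_le_one)
    simp only [Complex.reCLM_apply] at this
    rw [← this]
    congr 1
    ext ζ
    simp [hg]
  have han : AnalyticOnNhd ℂ (fun w ↦ H w - F w) (Metric.ball 0 1) :=
    hHd.sub ((hFd.mono Metric.ball_subset_closedBall).analyticOnNhd Metric.isOpen_ball)
  obtain ⟨k, hk⟩ := han.eq_const_of_re_eq_const (c₀ := 0)
    (fun w hw ↦ by simp [hre w hw]) Metric.isOpen_ball
    ((convex_ball (0 : ℂ) 1).isConnected ⟨0, by simp⟩)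
  have h0 : H 0 = ((Real.circleAverage g 0 1 : ℝ) : ℂ) := by
    have := Complex.ofRealCLM.circleAverage_comp_comm hgi
    simp only [Complex.ofRealCLM_apply] at this
    rw [← this, hH]
    refine Real.circleAverage_congr_sphere fun ζ hζ ↦ ?_
    have : ζ ≠ 0 := by rintro rfl; simp at hζ
    simp [herglotzRieszKernel_def, this]
  have h0b : (0 : ℂ) ∈ Metric.ball (0 : ℂ) 1 := by simp
  have hk0 := hk _ h0b
  have hkz := hk _ hz
  have hki : k = Complex.I * (G 0).re := by
    rw [← hk0]
    apply Complex.ext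
    · simp [hre 0 h0b]
    · rw [h0]; simp [hF]
  have : H z = F z + Complex.I * (G 0).re := by rw [← hki, ← hkz]; ring
  have h2 : Real.circleAverage (fun ζ ↦ herglotzRieszKernel 0 z ζ • ((G (r * ζ)).im : ℂ)) 0 1
      = H z := by
    simp only [hH, hg, hFre]
  rw [h2, this, hF]
  ring_nf
  simp

/-! ### Transfer to the upper half-plane: Cayley transform and Nevanlinna kernel. -/

/-- The Cayley transform, mapping the unit disc onto the upper half-plane and `0` to `i`. -/
noncomputable def cayley (ζ : ℂ) : ℂ := Complex.I * (1 + ζ) / (1 - ζ)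

/-- The inverse of the Cayley transform. -/
noncomputable def cayleyInv (w : ℂ) : ℂ := (w - Complex.I) / (w + Complex.I)

/-- The Nevanlinna kernel `(1 + w t) / (t - w)` at `t = tan ((θ - π) / 2)`, extended continuously
by the value `w` to the angles where the tangent is infinite. -/
noncomputable def angleKernel (w : ℂ) (θ : ℝ) : ℂ :=
  ((Real.cos ((θ - Real.pi) / 2) : ℂ) + w * (Real.sin ((θ - Real.pi) / 2) : ℂ)) /
    ((Real.sin ((θ - Real.pi) / 2) : ℂ) - w * (Real.cos ((θ - Real.pi) / 2) : ℂ))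

theorem isOpen_upperHalf : IsOpen upperHalf := isOpen_lt continuous_const Complex.continuous_im

theorem convex_upperHalf : Convex ℝ upperHalf := convex_halfSpace_im_gt 0

theorem add_I_ne_zero {w : ℂ} (hw : w ∈ upperHalf) : w + Complex.I ≠ 0 := by
  intro h
  have h1 := congrArg Complex.im h
  have h2 : 0 < w.im := hw
  simp at h1
  linarith

theorem one_sub_ne_zero_of_mem_ball {ζ : ℂ} (hζ : ζ ∈ Metric.ball (0 : ℂ) 1) : 1 - ζ ≠ 0 := by
  intro h
  have : ζ = 1 := (sub_eq_zero.1 h).symm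
  simp [this] at hζ

theorem cayleyInv_mem_ball {w : ℂ} (hw : w ∈ upperHalf) : cayleyInv w ∈ Metric.ball (0 : ℂ) 1 := by
  have h2 : 0 < w.im := hw
  rw [mem_ball_zero_iff, cayleyInv, norm_div, div_lt_one (norm_pos_iff.2 (add_I_ne_zero hw)),
    ← sq_lt_sq₀ (norm_nonneg _) (norm_nonneg _), ← Complex.normSq_eq_norm_sq,
    ← Complex.normSq_eq_norm_sq, Complex.normSq_apply, Complex.normSq_apply]
  simp
  nlinarith

theorem cayley_mem_upperHalf {ζ : ℂ} (hζ : ζ ∈ Metric.ball (0 : ℂ) 1) : cayley ζ ∈ upperHalf := by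
  have h1 := one_sub_ne_zero_of_mem_ball hζ
  have h2 : 0 < Complex.normSq (1 - ζ) := Complex.normSq_pos.2 h1
  have h3 : Complex.normSq ζ < 1 := by
    rw [Complex.normSq_eq_norm_sq]
    rw [mem_ball_zero_iff] at hζ
    nlinarith [norm_nonneg ζ]
  have : (cayley ζ).im = (1 - Complex.normSq ζ) / Complex.normSq (1 - ζ) := by
    rw [cayley, Complex.div_im, Complex.normSq_apply ζ]
    simp
    field_simp
    ring
  change 0 < (cayley ζ).im
  rw [this]
  exact div_pos (by linarith) h2

theorem cayley_cayleyInv {w : ℂ} (hw : w ∈ upperHalf) : cayley (cayleyInv w) = w := by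
  have h := add_I_ne_zero hw
  have h2 : 1 - cayleyInv w ≠ 0 := one_sub_ne_zero_of_mem_ball (cayleyInv_mem_ball hw)
  rw [cayley, div_eq_iff h2, cayleyInv]
  field_simp
  ring

theorem cayley_zero : cayley 0 = Complex.I := by simp [cayley]

theorem differentiableOn_cayley : DifferentiableOn ℂ cayley (Metric.ball 0 1) := by
  unfold cayley
  exact DifferentiableOn.div (by fun_prop) (by fun_prop) fun ζ hζ ↦ one_sub_ne_zero_of_mem_ball hζ

theorem ofReal_mul_mem_ball {r : ℝ} (hr : r ∈ Set.Ico (0 : ℝ) 1) {ζ : ℂ} (hζ : ‖ζ‖ ≤ 1) :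
    (r : ℂ) * ζ ∈ Metric.ball (0 : ℂ) 1 := by
  obtain ⟨h0, h1⟩ := hr
  rw [mem_ball_zero_iff, norm_mul, Complex.norm_real, Real.norm_eq_abs, abs_of_nonneg h0]
  nlinarith [norm_nonneg ζ]

theorem sin_sub_mul_cos_ne_zero {w : ℂ} (hw : w ∈ upperHalf) (ψ : ℝ) :
    (Real.sin ψ : ℂ) - w * (Real.cos ψ : ℂ) ≠ 0 := by
  intro h
  have h2 : 0 < w.im := hw
  have him := congrArg Complex.im h
  have hre := congrArg Complex.re h
  simp only [Complex.sub_im, Complex.ofReal_im, Complex.mul_im, Complex.ofReal_re,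
    Complex.zero_im, Complex.sub_re, Complex.mul_re, Complex.zero_re] at him hre
  have hc : Real.cos ψ = 0 := by
    have : w.im * Real.cos ψ = 0 := by linarith
    exact (mul_eq_zero.1 this).resolve_left h2.ne'
  have hs : Real.sin ψ = 0 := by rw [hc] at hre; linarith
  have := Real.sin_sq_add_cos_sq ψ
  rw [hc, hs] at this
  norm_num at this

theorem continuous_angleKernel {w : ℂ} (hw : w ∈ upperHalf) : Continuous (angleKernel w) := by
  unfold angleKernel
  exact Continuous.div (by fun_prop) (by fun_prop) fun θ ↦ sin_sub_mul_cos_ne_zero hw _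

/-- With `E = exp (iψ)` and `ψ = (θ - π)/2`, trigonometric identities between the circle and the
line become rational identities in `E`. -/
theorem exists_half_angle (θ : ℝ) : ∃ E : ℂ, E ≠ 0 ∧ circleMap 0 1 θ = -E ^ 2 ∧
    (Real.cos ((θ - Real.pi) / 2) : ℂ) = (E + E⁻¹) / 2 ∧
    (Real.sin ((θ - Real.pi) / 2) : ℂ) = (E⁻¹ - E) * Complex.I / 2 := by
  set ψ : ℝ := (θ - Real.pi) / 2 with hψ
  refine ⟨Complex.exp (ψ * Complex.I), Complex.exp_ne_zero _, ?_, ?_, ?_⟩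
  · have : (θ : ℂ) * Complex.I = 2 * (ψ * Complex.I) + Real.pi * Complex.I := by
      rw [hψ]; push_cast; ring
    rw [circleMap, this, Complex.exp_add, Complex.exp_pi_mul_I, two_mul, Complex.exp_add]
    simp; ring
  · rw [Complex.ofReal_cos, Complex.cos, ← Complex.exp_neg]; ring_nf
  · rw [Complex.ofReal_sin, Complex.sin, ← Complex.exp_neg]; ring_nf

/-- Under the Cayley transform the Herglotz kernel becomes the Nevanlinna kernel: after
substitution, numerator and denominator share the factor `2E/(w + i)`. -/
theorem I_mul_herglotzRieszKernel {w : ℂ} (hw : w ∈ upperHalf) (θ : ℝ) :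
    Complex.I * herglotzRieszKernel 0 (cayleyInv w) (circleMap 0 1 θ) = angleKernel w θ := by
  have h := add_I_ne_zero hw
  set ψ : ℝ := (θ - Real.pi) / 2 with hψ
  have hd := sin_sub_mul_cos_ne_zero hw ψ
  obtain ⟨E, hE0, hζ, hc, hs⟩ := exists_half_angle θ
  rw [← hψ] at hc hs
  have hden : circleMap 0 1 θ - cayleyInv w =
      2 * E / (w + Complex.I) * (Real.sin ψ - w * Real.cos ψ) := by
    rw [hζ, hc, hs, cayleyInv]
    field_simp
    ring
  have hnum : Complex.I * (circleMap 0 1 θ + cayleyInv w) =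
      2 * E / (w + Complex.I) * (Real.cos ψ + w * Real.sin ψ) := by
    rw [hζ, hc, hs, cayleyInv]
    field_simp
    ring_nf
    simp only [Complex.I_sq]
    ring
  have hne : 2 * E / (w + Complex.I) ≠ 0 :=
    div_ne_zero (mul_ne_zero two_ne_zero hE0) h
  rw [herglotzRieszKernel_def, angleKernel, ← hψ]
  simp only [sub_zero]
  rw [← mul_div_assoc, hnum, hden, mul_div_mul_left _ _ hne]

theorem norm_angleKernel_le {w : ℂ} (hw : w ∈ upperHalf) (θ : ℝ) :
    ‖angleKernel w θ‖ ≤ 2 / (1 - ‖cayleyInv w‖) := by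
  have hb := cayleyInv_mem_ball hw
  rw [mem_ball_zero_iff] at hb
  have hc : ‖circleMap 0 1 θ‖ = 1 := by simp
  rw [← I_mul_herglotzRieszKernel hw, norm_mul, Complex.norm_I, one_mul, herglotzRieszKernel_def,
    norm_div, sub_zero, sub_zero]
  have h1 := norm_add_le (circleMap 0 1 θ) (cayleyInv w)
  have h2 := norm_sub_norm_le (circleMap 0 1 θ) (cayleyInv w)
  rw [hc] at h1 h2
  exact div_le_div₀ (by norm_num) (by linarith) (by linarith) h2

theorem angleKernel_of_cos_eq_zero (w : ℂ) {θ : ℝ} (h : Real.cos ((θ - Real.pi) / 2) = 0) :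
    angleKernel w θ = w := by
  have hs : Real.sin ((θ - Real.pi) / 2) ≠ 0 := by
    intro hs
    have := Real.sin_sq_add_cos_sq ((θ - Real.pi) / 2)
    rw [h, hs] at this
    norm_num at this
  have : (Real.sin ((θ - Real.pi) / 2) : ℂ) ≠ 0 := Complex.ofReal_ne_zero.2 hs
  rw [angleKernel, h, Complex.ofReal_zero, zero_add, mul_zero, sub_zero, mul_div_cancel_right₀ _ this]

theorem angleKernel_of_cos_ne_zero (w : ℂ) {θ : ℝ} (h : Real.cos ((θ - Real.pi) / 2) ≠ 0) :
    angleKernel w θ = (1 + w * (Real.tan ((θ - Real.pi) / 2) : ℂ)) /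
      ((Real.tan ((θ - Real.pi) / 2) : ℂ) - w) := by
  have hc : (Real.cos ((θ - Real.pi) / 2) : ℂ) ≠ 0 := Complex.ofReal_ne_zero.2 h
  rw [angleKernel, Real.tan_eq_sin_div_cos, Complex.ofReal_div]
  generalize (Real.cos ((θ - Real.pi) / 2) : ℂ) = c at hc ⊢
  generalize (Real.sin ((θ - Real.pi) / 2) : ℂ) = s
  rw [← div_div_div_cancel_right₀ hc (c + w * s), add_div, sub_div, div_self hc, mul_div_assoc,
    mul_div_cancel_right₀ _ hc]

/-- The Schwarz integral formula for the circle of hyperbolic centre `i` that is the image of the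
circle of radius `r` under the Cayley transform. -/
theorem schwarz_formula_upperHalf {f : ℂ → ℂ} (hf : DifferentiableOn ℂ f upperHalf) {r : ℝ}
    (hr : r ∈ Set.Ico (0 : ℝ) 1) {w : ℂ} (hw : w ∈ upperHalf) :
    f (cayley (r * cayleyInv w)) = (f Complex.I).re + ∫ θ in Set.Ioc 0 (2 * Real.pi),
      angleKernel w θ *
        (((2 * Real.pi)⁻¹ * (f (cayley (r * circleMap 0 1 θ))).im : ℝ) : ℂ) := by
  have hG : DifferentiableOn ℂ (f ∘ cayley) (Metric.ball 0 1) :=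
    hf.comp differentiableOn_cayley fun ζ hζ ↦ cayley_mem_upperHalf hζ
  have := schwarz_formula_disc hG hr (cayleyInv_mem_ball hw)
  simp only [Function.comp_apply, cayley_zero] at this
  rw [this, Real.circleAverage_def, intervalIntegral.integral_of_le (by positivity),
    Complex.real_smul, ← mul_assoc, ← MeasureTheory.integral_const_mul]
  congr 2
  ext θ
  rw [← I_mul_herglotzRieszKernel hw, smul_eq_mul]
  push_cast
  ring

/-! ### Existence of the Nevanlinna representation. -/

/-- The density on `(0, 2π]` of the Poisson representation of `f` on the circle of radius `r`. -/
noncomputable def poissonDensity (f : ℂ → ℂ) (r θ : ℝ) : ℝ :=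
  (2 * Real.pi)⁻¹ * (f (cayley (r * circleMap 0 1 θ))).im

theorem ofReal_mul_circleMap_mem_ball {r : ℝ} (hr : r ∈ Set.Ico (0 : ℝ) 1) (θ : ℝ) :
    (r : ℂ) * circleMap 0 1 θ ∈ Metric.ball (0 : ℂ) 1 :=
  ofReal_mul_mem_ball hr (by simp)

theorem ClassH.poissonDensity_nonneg {f : ℂ → ℂ} (hf : ClassH f) {r : ℝ}
    (hr : r ∈ Set.Ico (0 : ℝ) 1) (θ : ℝ) : 0 ≤ poissonDensity f r θ :=
  mul_nonneg (by positivity)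
    (hf.2 _ (cayley_mem_upperHalf (ofReal_mul_circleMap_mem_ball hr θ)))

theorem continuous_poissonDensity {f : ℂ → ℂ} (hf : DifferentiableOn ℂ f upperHalf) {r : ℝ}
    (hr : r ∈ Set.Ico (0 : ℝ) 1) : Continuous (poissonDensity f r) := by
  unfold poissonDensity
  refine continuous_const.mul (Complex.continuous_im.comp ?_)
  have h1 : ContinuousOn (fun ζ ↦ f (cayley ζ)) (Metric.ball 0 1) :=
    hf.continuousOn.comp differentiableOn_cayley.continuousOn fun ζ hζ ↦ cayley_mem_upperHalf hζ
  exact h1.comp_continuous (by fun_prop) fun θ ↦ ofReal_mul_circleMap_mem_ball hr θ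

theorem angleKernel_I (θ : ℝ) : angleKernel Complex.I θ = Complex.I := by
  have hI : Complex.I ∈ upperHalf := by simp [upperHalf]
  rw [angleKernel, div_eq_iff (sin_sub_mul_cos_ne_zero hI _), mul_sub, ← mul_assoc,
    Complex.I_mul_I]
  ring

theorem cayleyInv_I : cayleyInv Complex.I = 0 := by simp [cayleyInv]

theorem I_mem_upperHalf : Complex.I ∈ upperHalf := by simp [upperHalf]

/-- The Schwarz formula at `i`, where the kernel is constant. The mass does not depend on `r`, which
gives the compactness used below. -/
theorem integral_poissonDensity {f : ℂ → ℂ} (hf : DifferentiableOn ℂ f upperHalf) {r : ℝ}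
    (hr : r ∈ Set.Ico (0 : ℝ) 1) :
    ∫ θ in Set.Ioc 0 (2 * Real.pi), poissonDensity f r θ = (f Complex.I).im := by
  have h := schwarz_formula_upperHalf hf hr I_mem_upperHalf
  simp only [cayleyInv_I, mul_zero, cayley_zero, angleKernel_I] at h
  rw [integral_const_mul, integral_complex_ofReal] at h
  have := congrArg Complex.im h
  simpa [poissonDensity] using this.symm

theorem tendsto_cayley_ofReal_mul {w : ℂ} (hw : w ∈ upperHalf) {l : Filter ℕ} {r : ℕ → ℝ}
    (hr : Tendsto r l (𝓝 1)) :
    Tendsto (fun n ↦ cayley (r n * cayleyInv w)) l (𝓝 w) := by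
  have hz := cayleyInv_mem_ball hw
  have hc : ContinuousAt cayley (cayleyInv w) :=
    (differentiableOn_cayley.differentiableAt (Metric.isOpen_ball.mem_nhds hz)).continuousAt
  rw [ContinuousAt, cayley_cayleyInv hw] at hc
  refine hc.comp ?_
  have : Tendsto (fun n ↦ (r n : ℂ)) l (𝓝 1) := by
    have := (Complex.continuous_ofReal.tendsto 1).comp hr
    rwa [Complex.ofReal_one] at this
  simpa using this.mul_const (cayleyInv w)

theorem measurable_tan_half : Measurable fun θ : ℝ ↦ Real.tan ((θ - Real.pi) / 2) := by
  simp only [Real.tan_eq_sin_div_cos]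
  fun_prop

theorem exists_radii_tendsto_one :
    ∃ r : ℕ → ℝ, (∀ n, r n ∈ Set.Ico (0 : ℝ) 1) ∧ Tendsto r atTop (𝓝 1) := by
  obtain ⟨r, -, hr, hr1⟩ := exists_seq_strictMono_tendsto' (zero_lt_one (α := ℝ))
  exact ⟨r, fun n ↦ Set.Ioo_subset_Ico_self (hr n), hr1⟩

/-- The Poisson densities on circles of radius `r n → 1` are measures of mass `Im f(i)` carried by
`[0, 2π]`, hence lie in a weakly compact set. The kernel is bounded and continuous in the angle, so
the Schwarz formula passes to a weak limit. -/
theorem exists_angular_measure {f : ℂ → ℂ} (hf : ClassH f) :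
    ∃ μ : FiniteMeasure ℝ, ∀ w ∈ upperHalf,
      f w = (f Complex.I).re + ∫ θ, angleKernel w θ ∂(μ : Measure ℝ) := by
  obtain ⟨r, hr, hr1⟩ := exists_radii_tendsto_one
  set ν : Measure ℝ := volume.restrict (Set.Ioc 0 (2 * Real.pi)) with hν
  have hint : ∀ n, Integrable (poissonDensity f (r n)) ν := fun n ↦
    ((continuous_poissonDensity hf.1 (hr n)).integrableOn_Icc).mono_set Set.Ioc_subset_Icc_self
  have hfin : ∀ n, IsFiniteMeasure
      (ν.withDensity fun θ ↦ ENNReal.ofReal (poissonDensity f (r n) θ)) := fun n ↦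
    isFiniteMeasure_withDensity_ofReal (hint n).2
  set m : ℕ → FiniteMeasure ℝ := fun n ↦ ⟨_, hfin n⟩ with hm
  have hK := isCompact_setOfPred_finiteMeasure_le_of_isCompact (E := ℝ) (f Complex.I).im.toNNReal
    (isCompact_Icc (a := (0 : ℝ)) (b := 2 * Real.pi))
  have hmK : ∀ n, m n ∈ {μ : FiniteMeasure ℝ | μ.mass ≤ (f Complex.I).im.toNNReal ∧
      μ (Set.Icc 0 (2 * Real.pi))ᶜ = 0} := by
    intro n
    constructor
    · rw [← ENNReal.coe_le_coe, FiniteMeasure.ennreal_mass]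
      simp only [hm, FiniteMeasure.toMeasure_mk]
      rw [withDensity_apply _ MeasurableSet.univ, Measure.restrict_univ,
        ← ofReal_integral_eq_lintegral_ofReal (hint n)
          (ae_of_all _ fun θ ↦ hf.poissonDensity_nonneg (hr n) θ),
        integral_poissonDensity hf.1 (hr n)]
      rfl
    · rw [FiniteMeasure.null_iff_toMeasure_null]
      simp only [hm, FiniteMeasure.toMeasure_mk]
      refine withDensity_absolutelyContinuous _ _ ?_
      rw [hν, Measure.restrict_apply measurableSet_Icc.compl]
      convert! measure_empty (μ := (volume : Measure ℝ))
      ext θ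
      simp only [Set.mem_inter_iff, Set.mem_compl_iff, Set.mem_Icc, Set.mem_Ioc,
        Set.mem_empty_iff_false, iff_false]
      rintro ⟨h1, h2, h3⟩
      exact h1 ⟨h2.le, h3⟩
  -- A limit along an ultrafilter replaces the extraction of a convergent subsequence.
  obtain ⟨μ, -, hμ⟩ := hK.ultrafilter_le_nhds ((Ultrafilter.of atTop).map m)
    (le_principal_iff.2 (mem_map.2 (Eventually.of_forall hmK)))
  have hμ' : Tendsto m ((Ultrafilter.of atTop : Ultrafilter ℕ) : Filter ℕ) (𝓝 μ) := hμ
  refine ⟨μ, fun w hw ↦ ?_⟩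
  rw [FiniteMeasure.tendsto_iff_forall_integral_rclike_tendsto ℂ] at hμ'
  have h1 := hμ' (BoundedContinuousFunction.ofNormedAddCommGroup (angleKernel w)
    (continuous_angleKernel hw) _ (norm_angleKernel_le hw))
  simp only [BoundedContinuousFunction.coe_ofNormedAddCommGroup] at h1
  have hr1' : Tendsto r ((Ultrafilter.of atTop : Ultrafilter ℕ) : Filter ℕ) (𝓝 1) :=
    hr1.mono_left (Ultrafilter.of_le atTop)
  have h2 : Tendsto (fun n ↦ f (cayley (r n * cayleyInv w))) ((Ultrafilter.of atTop : Ultrafilter ℕ) : Filter ℕ)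
      (𝓝 (f w)) :=
    ((hf.1.differentiableAt (isOpen_upperHalf.mem_nhds hw)).continuousAt.tendsto).comp
      (tendsto_cayley_ofReal_mul hw hr1')
  refine tendsto_nhds_unique h2 ((tendsto_const_nhds.add h1).congr fun n ↦ ?_)
  rw [schwarz_formula_upperHalf hf.1 (hr n) hw]
  congr 1
  simp only [hm, FiniteMeasure.toMeasure_mk]
  rw [integral_withDensity_eq_integral_toReal_smul
    (continuous_poissonDensity hf.1 (hr n)).measurable.ennreal_ofReal
    (ae_of_all _ fun θ ↦ ENNReal.ofReal_lt_top)]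
  refine integral_congr_ae (ae_of_all _ fun θ ↦ ?_)
  simp only
  rw [ENNReal.toReal_ofReal (hf.poissonDensity_nonneg (hr n) θ), Complex.real_smul, mul_comm]
  rfl

/-- **Nevanlinna representation theorem** (existence part). -/
theorem ClassH.exists_represents {f : ℂ → ℂ} (hf : ClassH f) :
    ∃ D : NevanlinnaData, D.Represents f := by
  obtain ⟨μ, hμ⟩ := exists_angular_measure hf
  -- These are the angles sent to `∞`, where the kernel equals `w`: their mass becomes `α`. The rest
  -- is pushed to the line by the tangent, whose value at the angles in `A` is only a default.
  set A : Set ℝ := {θ | Real.cos ((θ - Real.pi) / 2) = 0} with hA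
  have hAm : MeasurableSet A := (isClosed_eq (by fun_prop) continuous_const).measurableSet
  refine ⟨⟨(μ : Measure ℝ).real A, (f Complex.I).re,
    ((μ : Measure ℝ).restrict Aᶜ).map fun θ : ℝ ↦ Real.tan ((θ - Real.pi) / 2),
    measureReal_nonneg, inferInstance⟩, fun w hw ↦ ?_⟩
  simp only
  have hi : Integrable (angleKernel w) (μ : Measure ℝ) :=
    .of_bound (continuous_angleKernel hw).aestronglyMeasurable _
      (ae_of_all _ (norm_angleKernel_le hw))
  rw [hμ w hw, ← integral_add_compl hAm hi,
    setIntegral_congr_fun hAm (g := fun _ ↦ w) (fun θ hθ ↦ angleKernel_of_cos_eq_zero w hθ),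
    setIntegral_congr_fun hAm.compl (fun θ hθ ↦ angleKernel_of_cos_ne_zero w hθ),
    integral_map measurable_tan_half.aemeasurable
      (by exact Measurable.aestronglyMeasurable (by fun_prop)),
    setIntegral_const, Complex.real_smul]
  ring

/-! ### Exponential representation from the sign of the boundary values. -/

/-- The measure `dt / (π (1 + t²))`, the harmonic measure of the upper half-plane at `i`, as the
image of the normalised angle on the circle. -/
noncomputable def cauchyMeasure : Measure ℝ :=
  (ENNReal.ofReal (2 * Real.pi)⁻¹ • volume.restrict (Set.Ioc 0 (2 * Real.pi))).map
    fun θ ↦ Real.tan ((θ - Real.pi) / 2)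

instance isFiniteMeasure_cauchyMeasure : IsFiniteMeasure cauchyMeasure := by
  unfold cauchyMeasure
  have : IsFiniteMeasure (ENNReal.ofReal (2 * Real.pi)⁻¹ •
      (volume : Measure ℝ).restrict (Set.Ioc 0 (2 * Real.pi))) :=
    Measure.smul_finite _ ENNReal.ofReal_ne_top
  infer_instance

/-- The branch of the logarithm on the closed upper half-plane without `0`
with imaginary part in `[0, π]`. -/
noncomputable def upperLog (w : ℂ) : ℂ := Complex.log (-Complex.I * w) + Real.pi / 2 * Complex.I

/-- Rotation by `-i` puts both real rays on the imaginary axis, away from the cut of the principal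
logarithm; so `upperLog` is continuous up to the real line, except at `0`. -/
theorem neg_I_mul_mem_slitPlane {w : ℂ} (hw : 0 ≤ w.im) (h0 : w ≠ 0) :
    -Complex.I * w ∈ Complex.slitPlane := by
  rw [Complex.mem_slitPlane_iff]
  by_cases h : w.im = 0
  · right
    simp
    intro hre
    exact h0 (Complex.ext hre h)
  · left
    simpa using lt_of_le_of_ne hw (Ne.symm h)

theorem exp_upperLog {w : ℂ} (h0 : w ≠ 0) : Complex.exp (upperLog w) = w := by
  rw [upperLog, Complex.exp_add, Complex.exp_log (mul_ne_zero (by simp) h0),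
    Complex.exp_pi_div_two_mul_I]
  linear_combination (-w) * Complex.I_sq

theorem upperLog_re {w : ℂ} : (upperLog w).re = Real.log ‖w‖ := by
  simp [upperLog, Complex.log_re]

theorem upperLog_im_mem_Icc {w : ℂ} (hw : 0 ≤ w.im) :
    (upperLog w).im ∈ Set.Icc 0 Real.pi := by
  have h : |Complex.arg (-Complex.I * w)| ≤ Real.pi / 2 :=
    Complex.abs_arg_le_pi_div_two_iff.2 (by simpa using hw)
  rw [abs_le] at h
  have : (upperLog w).im = Complex.arg (-Complex.I * w) + Real.pi / 2 := by
    simp [upperLog, Complex.log_im]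
  rw [this]
  constructor <;> linarith [h.1, h.2]

theorem upperLog_ofReal_of_pos {v : ℝ} (hv : 0 < v) : (upperLog v).im = 0 := by
  have : -Complex.I * (v : ℂ) = (v : ℂ) * -Complex.I := by ring
  rw [upperLog, this]
  simp only [Complex.add_im, Complex.log_im, Complex.arg_real_mul _ hv]
  simp

theorem upperLog_ofReal_of_neg {v : ℝ} (hv : v < 0) : (upperLog v).im = Real.pi := by
  have : -Complex.I * (v : ℂ) = ((-v : ℝ) : ℂ) * Complex.I := by push_cast; ring
  rw [upperLog, this]
  simp only [Complex.add_im, Complex.log_im, Complex.arg_real_mul _ (neg_pos.2 hv)]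
  simp

theorem continuousAt_upperLog {w : ℂ} (hw : 0 ≤ w.im) (h0 : w ≠ 0) : ContinuousAt upperLog w := by
  unfold upperLog
  exact (ContinuousAt.clog (by fun_prop) (neg_I_mul_mem_slitPlane hw h0)).add continuousAt_const

theorem differentiableOn_upperLog_comp {h : ℂ → ℂ} (hh : ClassH h)
    (h0 : ∀ z ∈ upperHalf, h z ≠ 0) :
    DifferentiableOn ℂ (fun z ↦ upperLog (h z)) upperHalf := by
  unfold upperLog
  exact ((hh.1.const_mul _).clog fun z hz ↦ neg_I_mul_mem_slitPlane (hh.2 z hz) (h0 z hz)).add_const _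

theorem circleMap_ne_one {θ : ℝ} (hθ : θ ∈ Set.Ioo 0 (2 * Real.pi)) : circleMap 0 1 θ ≠ 1 := by
  intro h
  have h1 : circleMap 0 1 θ = circleMap 0 1 0 := by rw [h]; simp [circleMap]
  have := (injOn_circleMap_of_abs_sub_le' (c := 0) (one_ne_zero (α := ℝ)) (a := 0) (b := 2 * Real.pi)
    (by simp)) ⟨hθ.1.le, hθ.2⟩ ⟨le_rfl, by positivity⟩ h1
  exact hθ.1.ne' this

theorem cayley_circleMap {θ : ℝ} (hθ : θ ∈ Set.Ioo 0 (2 * Real.pi)) :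
    cayley (circleMap 0 1 θ) = Real.tan ((θ - Real.pi) / 2) := by
  set ψ : ℝ := (θ - Real.pi) / 2 with hψ
  have hcpos : 0 < Real.cos ψ :=
    Real.cos_pos_of_mem_Ioo ⟨by rw [hψ]; linarith [hθ.1], by rw [hψ]; linarith [hθ.2]⟩
  have hcne : (Real.cos ψ : ℂ) ≠ 0 := Complex.ofReal_ne_zero.2 hcpos.ne'
  obtain ⟨E, hE0, hζ, hc, hs⟩ := exists_half_angle θ
  rw [← hψ] at hc hs
  have hne : 1 - circleMap 0 1 θ ≠ 0 := sub_ne_zero.2 (circleMap_ne_one hθ).symm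
  rw [Real.tan_eq_sin_div_cos, Complex.ofReal_div, eq_div_iff hcne, cayley, div_mul_eq_mul_div,
    div_eq_iff hne, hζ, hc, hs]
  field_simp
  ring

/-- The angles corresponding to a null subset of the line form a null set. -/
theorem cauchyMeasure_absolutelyContinuous : cauchyMeasure ≪ volume := by
  refine Measure.AbsolutelyContinuous.mk fun s hs h0 ↦ ?_
  rw [cauchyMeasure, Measure.map_apply measurable_tan_half hs, Measure.smul_apply,
    Measure.restrict_congr_set Ioo_ae_eq_Ioc.symm,
    Measure.restrict_apply (measurable_tan_half hs)]
  suffices h : volume ((fun θ : ℝ ↦ Real.tan ((θ - Real.pi) / 2)) ⁻¹' s ∩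
      Set.Ioo 0 (2 * Real.pi)) = 0 by simp [h]
  -- On the open interval the tangent inverts `t ↦ 2 arctan t + π`, and a differentiable map sends
  -- null sets to null sets.
  refine measure_mono_null (t := (fun t ↦ 2 * Real.arctan t + Real.pi) '' s) ?_
    (addHaar_image_eq_zero_of_differentiableOn_of_addHaar_eq_zero volume
      ((Real.differentiable_arctan.const_mul 2).add_const _).differentiableOn h0)
  rintro θ ⟨h1, h2⟩
  refine ⟨_, h1, ?_⟩
  simp only
  rw [Real.arctan_tan (by linarith [h2.1]) (by linarith [h2.2])]
  ring

/-- Carries almost-everywhere statements from the line to the angles. The angle `2π` is dropped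
because the Cayley transform has its pole there. -/
theorem ae_restrict_Ioc_of_ae {p : ℝ → Prop} (hp : ∀ᵐ t, p t) :
    ∀ᵐ θ ∂(volume.restrict (Set.Ioc 0 (2 * Real.pi))), θ ∈ Set.Ioo 0 (2 * Real.pi) ∧
      p (Real.tan ((θ - Real.pi) / 2)) := by
  have h1 : ∀ᵐ t ∂cauchyMeasure, p t := cauchyMeasure_absolutelyContinuous.ae_le hp
  have h2 := ae_of_ae_map measurable_tan_half.aemeasurable h1
  rw [Measure.ae_ennreal_smul_measure_iff (by simp; positivity)] at h2
  refine Eventually.and ?_ h2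
  rw [Measure.restrict_congr_set Ioo_ae_eq_Ioc.symm]
  exact ae_restrict_mem measurableSet_Ioo

/-- A nonvanishing function of class `𝓗` with real nonzero boundary values almost everywhere is
determined up to its modulus at `i` by the set where the boundary values are negative. -/
theorem ClassH.eq_norm_mul_exp {h : ℂ → ℂ} (hh : ClassH h) (h0 : ∀ z ∈ upperHalf, h z ≠ 0)
    {S : Set ℝ} (hS : MeasurableSet S) {v : ℝ → ℝ}
    (hlim : ∀ᵐ t : ℝ, Tendsto h (𝓝[upperHalf] (t : ℂ)) (𝓝 (v t : ℂ)))
    (hneg : ∀ᵐ t : ℝ, t ∈ S → v t < 0) (hpos : ∀ᵐ t : ℝ, t ∉ S → 0 < v t)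
    {w : ℂ} (hw : w ∈ upperHalf) :
    h w = (‖h Complex.I‖ : ℂ) * Complex.exp (Real.pi *
      ∫ t in S, (1 + w * (t : ℂ)) / ((t : ℂ) - w) ∂cauchyMeasure) := by
  -- The imaginary part of the logarithm is bounded, so the Poisson integrals converge by dominated
  -- convergence and no singular measure can appear in the limit.
  set g : ℂ → ℂ := fun z ↦ upperLog (h z) with hg
  have hgd : DifferentiableOn ℂ g upperHalf := differentiableOn_upperLog_comp hh h0
  obtain ⟨r, hr, hr1⟩ := exists_radii_tendsto_one
  have hr1c : Tendsto (fun n ↦ (r n : ℂ)) atTop (𝓝 1) := by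
    have := (Complex.continuous_ofReal.tendsto 1).comp hr1
    rwa [Complex.ofReal_one] at this
  -- The almost-everywhere boundary value of `Im g`.
  set u : ℝ → ℝ := S.indicator fun _ ↦ Real.pi with hu
  have hpt : ∀ᵐ θ ∂(volume.restrict (Set.Ioc 0 (2 * Real.pi))),
      Tendsto (fun n ↦ angleKernel w θ *
        (((2 * Real.pi)⁻¹ * (g (cayley (r n * circleMap 0 1 θ))).im : ℝ) : ℂ)) atTop
        (𝓝 (angleKernel w θ *
          (((2 * Real.pi)⁻¹ * u (Real.tan ((θ - Real.pi) / 2)) : ℝ) : ℂ))) := by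
    filter_upwards [ae_restrict_Ioc_of_ae (hlim.and (hneg.and hpos))] with θ hθ
    obtain ⟨hθ, hl, hn, hp⟩ := hθ
    set t := Real.tan ((θ - Real.pi) / 2) with ht
    have hne : 1 - circleMap 0 1 θ ≠ 0 := sub_ne_zero.2 (circleMap_ne_one hθ).symm
    have hca : ContinuousAt cayley (circleMap 0 1 θ) :=
      ContinuousAt.div (by fun_prop) (by fun_prop) hne
    have h1 : Tendsto (fun n ↦ cayley (r n * circleMap 0 1 θ)) atTop (𝓝[upperHalf] (t : ℂ)) := by
      refine tendsto_nhdsWithin_iff.2 ⟨?_, Eventually.of_forall fun n ↦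
        cayley_mem_upperHalf (ofReal_mul_circleMap_mem_ball (hr n) θ)⟩
      rw [ht, ← cayley_circleMap hθ]
      refine hca.tendsto.comp ?_
      simpa using hr1c.mul_const (circleMap 0 1 θ)
    have hv0 : v t ≠ 0 := by
      by_cases htS : t ∈ S
      · exact (hn htS).ne
      · exact (hp htS).ne'
    have h2 : Tendsto (fun n ↦ (g (cayley (r n * circleMap 0 1 θ))).im) atTop (𝓝 (u t)) := by
      have h3 := (Complex.continuous_im.tendsto _).comp
        ((continuousAt_upperLog (w := (v t : ℂ)) (by simp) (by simpa using hv0)).tendsto.comp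
          (hl.comp h1))
      have h4 : (upperLog (v t)).im = u t := by
        by_cases htS : t ∈ S
        · rw [upperLog_ofReal_of_neg (hn htS), hu, Set.indicator_of_mem htS]
        · rw [upperLog_ofReal_of_pos (hp htS), hu, Set.indicator_of_notMem htS]
      rwa [h4] at h3
    exact ((Complex.continuous_ofReal.tendsto _).comp (h2.const_mul _)).const_mul _
  have hG0 : (g Complex.I).re = Real.log ‖h Complex.I‖ := upperLog_re
  have hlimI : Tendsto (fun n ↦ g (cayley (r n * cayleyInv w))) atTop
      (𝓝 ((g Complex.I).re + ∫ θ in Set.Ioc 0 (2 * Real.pi), angleKernel w θ *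
          (((2 * Real.pi)⁻¹ * u (Real.tan ((θ - Real.pi) / 2)) : ℝ) : ℂ))) := by
    simp only [fun n ↦ schwarz_formula_upperHalf hgd (hr n) hw]
    refine tendsto_const_nhds.add ?_
    -- The bound is the supremum bound of the kernel times `(2π)⁻¹ π`, since `0 ≤ Im g ≤ π`.
    refine tendsto_integral_of_dominated_convergence
      (fun _ ↦ 2 / (1 - ‖cayleyInv w‖) * ((2 * Real.pi)⁻¹ * Real.pi)) (fun n ↦ ?_)
      (integrable_const _) (fun n ↦ ae_of_all _ fun θ ↦ ?_) hpt
    · exact ((continuous_angleKernel hw).mul (Complex.continuous_ofReal.comp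
        (continuous_poissonDensity hgd (hr n)))).aestronglyMeasurable
    · rw [norm_mul, Complex.norm_real, norm_mul]
      have hm := upperLog_im_mem_Icc (hh.2 _ (cayley_mem_upperHalf
        (ofReal_mul_circleMap_mem_ball (hr n) θ)))
      have h3 : ‖(g (cayley (r n * circleMap 0 1 θ))).im‖ ≤ Real.pi := by
        rw [Real.norm_eq_abs, abs_of_nonneg hm.1]
        exact hm.2
      have h4 : ‖(2 * Real.pi)⁻¹‖ = (2 * Real.pi)⁻¹ := by
        rw [Real.norm_eq_abs, abs_of_pos (by positivity)]
      rw [h4]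
      exact mul_le_mul (norm_angleKernel_le hw θ) (by gcongr) (by positivity)
        ((norm_nonneg _).trans (norm_angleKernel_le hw θ))
  have hlimg : Tendsto (fun n ↦ g (cayley (r n * cayleyInv w))) atTop (𝓝 (g w)) :=
    ((hgd.differentiableAt (isOpen_upperHalf.mem_nhds hw)).continuousAt.tendsto).comp
      (tendsto_cayley_ofReal_mul hw hr1)
  have hgw := tendsto_nhds_unique hlimg hlimI
  have hint : ∫ θ in Set.Ioc 0 (2 * Real.pi), angleKernel w θ *
          (((2 * Real.pi)⁻¹ * u (Real.tan ((θ - Real.pi) / 2)) : ℝ) : ℂ) =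
      Real.pi * ∫ t in S, (1 + w * (t : ℂ)) / ((t : ℂ) - w) ∂cauchyMeasure := by
    rw [← integral_indicator hS, cauchyMeasure, integral_map measurable_tan_half.aemeasurable
      (by
        refine Measurable.aestronglyMeasurable (Measurable.indicator ?_ hS)
        fun_prop), integral_smul_measure, ENNReal.toReal_ofReal (by positivity),
      Complex.real_smul, ← mul_assoc, ← integral_const_mul]
    refine integral_congr_ae ?_
    filter_upwards [ae_restrict_Ioc_of_ae (ae_of_all _ fun _ ↦ trivial)] with θ hθ
    obtain ⟨hθ, -⟩ := hθ
    have hcpos : 0 < Real.cos ((θ - Real.pi) / 2) :=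
      Real.cos_pos_of_mem_Ioo ⟨by linarith [hθ.1], by linarith [hθ.2]⟩
    rw [angleKernel_of_cos_ne_zero w hcpos.ne', hu]
    by_cases htS : Real.tan ((θ - Real.pi) / 2) ∈ S
    · rw [Set.indicator_of_mem htS, Set.indicator_of_mem htS]
      push_cast
      ring
    · rw [Set.indicator_of_notMem htS, Set.indicator_of_notMem htS]
      simp
  rw [hint, hG0] at hgw
  rw [← exp_upperLog (h0 w hw)]
  change Complex.exp (g w) = _
  rw [hgw, Complex.exp_add, ← Complex.ofReal_exp,
    Real.exp_log (norm_pos_iff.2 (h0 _ I_mem_upperHalf))]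

/-! ### The real extension of `f` off the support. -/

namespace NevanlinnaData

variable (D : NevanlinnaData)

instance : IsFiniteMeasure D.ρ := D.finite

/-- The right-hand side of the Nevanlinna formula at a complex number. -/
noncomputable def eval (w : ℂ) : ℂ :=
  (D.α : ℂ) * w + (D.β : ℂ) + ∫ t : ℝ, (1 + w * (t : ℂ)) / ((t : ℂ) - w) ∂D.ρ

theorem eval_ofReal (x : ℝ) : D.eval (x : ℂ) = (D.realValue x : ℂ) := by
  simp only [eval, realValue]
  push_cast
  rw [← integral_complex_ofReal]
  congr 2
  ext t
  push_cast
  rfl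

theorem exists_ball_null {x : ℝ} (hx : x ∉ D.ρ.support) :
    ∃ δ > 0, D.ρ (Metric.ball x δ) = 0 := by
  obtain ⟨U, hU, h0⟩ := Measure.notMem_support_iff_exists.1 hx
  obtain ⟨δ, hδ, hb⟩ := Metric.mem_nhds_iff.1 hU
  exact ⟨δ, hδ, measure_mono_null hb h0⟩

end NevanlinnaData

/-- The kernel equals `w + (1 + w²)/(t - w)`, which stays bounded in `t` even though its numerator
grows. -/
theorem norm_nevanlinna_kernel_le {w : ℂ} {t δ M : ℝ} (hδ : 0 < δ) (h : δ ≤ ‖(t : ℂ) - w‖)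
    (hM : ‖w‖ ≤ M) : ‖(1 + w * (t : ℂ)) / ((t : ℂ) - w)‖ ≤ M + (1 + M ^ 2) / δ := by
  have hne : (t : ℂ) - w ≠ 0 := norm_pos_iff.1 (hδ.trans_le h)
  have hM0 : 0 ≤ M := (norm_nonneg w).trans hM
  have heq : (1 + w * (t : ℂ)) / ((t : ℂ) - w) = w + (1 + w ^ 2) / ((t : ℂ) - w) := by
    field_simp
    ring
  rw [heq]
  refine (norm_add_le _ _).trans (add_le_add hM ?_)
  rw [norm_div]
  refine div_le_div₀ (by positivity) ((norm_add_le _ _).trans ?_) hδ h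
  rw [norm_one, norm_pow]
  gcongr

namespace NevanlinnaData

variable (D : NevanlinnaData)

theorem continuousAt_eval {x : ℝ} (hx : x ∉ D.ρ.support) : ContinuousAt D.eval (x : ℂ) := by
  obtain ⟨δ, hδ, h0⟩ := D.exists_ball_null hx
  have hae : ∀ᵐ t : ℝ ∂D.ρ, δ ≤ ‖(t : ℂ) - (x : ℂ)‖ := by
    filter_upwards [measure_eq_zero_iff_ae_notMem.1 h0] with t ht
    rw [Metric.mem_ball, not_lt, Real.dist_eq] at ht
    rwa [← Complex.ofReal_sub, Complex.norm_real]
  unfold eval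
  refine ContinuousAt.add (by fun_prop) ?_
  refine continuousAt_of_dominated
    (bound := fun _ ↦ (|x| + δ / 2) + (1 + (|x| + δ / 2) ^ 2) / (δ / 2))
    (Eventually.of_forall fun w ↦ Measurable.aestronglyMeasurable (by fun_prop)) ?_
    (integrable_const _) ?_
  · filter_upwards [Metric.ball_mem_nhds (x : ℂ) (half_pos hδ)] with w hw
    -- For `w` within `δ/2` of `x`, almost every `t` is at distance at least `δ/2` from `w`.
    rw [mem_ball_iff_norm] at hw
    filter_upwards [hae] with t ht
    refine norm_nevanlinna_kernel_le (half_pos hδ) ?_ ?_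
    · have := norm_sub_le_norm_sub_add_norm_sub (t : ℂ) w x
      linarith
    · have := norm_sub_norm_le w x
      rw [Complex.norm_real, Real.norm_eq_abs] at this
      linarith
  · filter_upwards [hae] with t ht
    exact ContinuousAt.div (by fun_prop) (by fun_prop) (norm_pos_iff.1 (hδ.trans_le ht))

theorem continuousAt_realValue_coe {x : ℝ} (hx : x ∉ D.ρ.support) :
    ContinuousAt (fun y : ℝ ↦ D.realValue y) x := by
  have h : ContinuousAt (fun y : ℝ ↦ (D.eval y).re) x :=
    Complex.continuous_re.continuousAt.comp
      (ContinuousAt.comp (f := ((↑) : ℝ → ℂ)) (D.continuousAt_eval hx)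
        Complex.continuous_ofReal.continuousAt)
  simpa only [eval_ofReal, Complex.ofReal_re] using h

theorem tendsto_realValue_infty (h0 : D.α = 0) (hb : Bornology.IsBounded D.ρ.support) :
    Tendsto (fun x : ℝ ↦ D.realValue x) (Bornology.cobounded ℝ) (𝓝 (D.realValue ∞)) := by
  obtain ⟨R, hR0, hR⟩ := hb.exists_pos_norm_le
  have hae : ∀ᵐ t ∂D.ρ, |t| ≤ R := by
    filter_upwards [D.ρ.support_mem_ae] with t ht using hR t ht
  have hcg : (Bornology.cobounded ℝ).IsCountablyGenerated := by
    rw [← comap_norm_atTop]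
    infer_instance
  simp only [realValue, h0, zero_mul, zero_add, sub_eq_add_neg, ← integral_neg]
  refine tendsto_const_nhds.add ?_
  refine tendsto_integral_filter_of_dominated_convergence (fun _ ↦ 2 * (1 + R))
    (Eventually.of_forall fun x ↦ Measurable.aestronglyMeasurable (by fun_prop)) ?_
    (integrable_const _) ?_
  · have hlarge : ∀ᶠ x : ℝ in Bornology.cobounded ℝ, 2 * R + 1 ≤ ‖x‖ :=
      tendsto_norm_cobounded_atTop.eventually_ge_atTop _
    filter_upwards [hlarge] with x hx
    filter_upwards [hae] with t ht
    rw [Real.norm_eq_abs] at hx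
    have h1 : |x| / 2 ≤ |t + -x| := by
      have := abs_sub_abs_le_abs_sub x t
      rw [abs_sub_comm, sub_eq_add_neg t x] at this
      linarith
    have h2 : |1 + x * t| ≤ |x| * (1 + R) := by
      have := abs_add_le 1 (x * t)
      rw [abs_one, abs_mul] at this
      nlinarith [abs_nonneg x, abs_nonneg t]
    rw [norm_div, Real.norm_eq_abs, Real.norm_eq_abs, div_le_iff₀ (by linarith)]
    nlinarith
  · filter_upwards with t
    -- The kernel rewritten as `-t + (1 + t²)/(t - x)`, whose limit at `x → ∞` is visible.
    have h1 : Tendsto (fun x : ℝ ↦ -t + (1 + t ^ 2) * (t - x)⁻¹) (Bornology.cobounded ℝ)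
        (𝓝 (-t + (1 + t ^ 2) * 0)) := by
      refine tendsto_const_nhds.add (tendsto_const_nhds.mul
        (tendsto_inv₀_cobounded.comp ?_))
      exact tendsto_const_sub_cobounded t
    rw [mul_zero, add_zero] at h1
    refine h1.congr' ?_
    filter_upwards [tendsto_norm_cobounded_atTop.eventually_gt_atTop |t|] with x hx
    have : t - x ≠ 0 := by
      intro h
      rw [sub_eq_zero.1 h, Real.norm_eq_abs] at hx
      exact lt_irrefl _ hx
    rw [← sub_eq_add_neg]
    field_simp
    ring

theorem infty_notMem_sigma_iff :
    ∞ ∉ D.sigma ↔ D.α = 0 ∧ Bornology.IsBounded D.ρ.support := by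
  have : (∞ : OnePoint ℝ) ∉ ((↑) : ℝ → OnePoint ℝ) '' D.ρ.support := OnePoint.infty_notMem_image_coe
  simp only [sigma, Set.mem_union, this, Set.mem_ofPred_eq, true_and, false_or, not_or, not_lt,
    not_not]
  exact and_congr_left fun _ ↦ ⟨fun h ↦ le_antisymm h D.α_nonneg, fun h ↦ h.le⟩

theorem coe_mem_sigma_iff {x : ℝ} : (x : OnePoint ℝ) ∈ D.sigma ↔ x ∈ D.ρ.support := by
  simp [sigma]

theorem isClosed_sigma : IsClosed D.sigma := by
  have hpre : ((↑) : ℝ → OnePoint ℝ) ⁻¹' D.sigma = D.ρ.support := by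
    ext x
    exact D.coe_mem_sigma_iff
  by_cases h : ∞ ∈ D.sigma
  · rw [OnePoint.isClosed_iff_of_mem h, hpre]
    exact Measure.isClosed_support
  · rw [OnePoint.isClosed_iff_of_notMem h, hpre]
    exact ⟨Measure.isClosed_support,
      Metric.isCompact_of_isClosed_isBounded Measure.isClosed_support (D.infty_notMem_sigma_iff.1 h).2⟩

theorem continuousAt_realValue {x : OnePoint ℝ} (hx : x ∉ D.sigma) :
    ContinuousAt D.realValue x := by
  induction x using OnePoint.rec with
  | infty =>
    obtain ⟨h0, hb⟩ := D.infty_notMem_sigma_iff.1 hx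
    rw [OnePoint.continuousAt_infty', coclosedCompact_eq_cocompact,
      ← Metric.cobounded_eq_cocompact]
    exact D.tendsto_realValue_infty h0 hb
  | coe x =>
    rw [OnePoint.continuousAt_coe]
    exact D.continuousAt_realValue_coe fun h ↦ hx (D.coe_mem_sigma_iff.2 h)

theorem integrable_kernel {x δ : ℝ} (hδ : 0 < δ) (h0 : D.ρ (Metric.ball x δ) = 0) :
    Integrable (fun t : ℝ ↦ (1 + x * t) / (t - x)) D.ρ := by
  refine .of_bound (Measurable.aestronglyMeasurable (by fun_prop)) (|x| + (1 + |x| ^ 2) / δ) ?_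
  filter_upwards [measure_eq_zero_iff_ae_notMem.1 h0] with t ht
  rw [Metric.mem_ball, not_lt, Real.dist_eq] at ht
  have := norm_nevanlinna_kernel_le (w := x) (t := t) (M := |x|) hδ
    (by rwa [← Complex.ofReal_sub, Complex.norm_real]) (by simp)
  rw [← Complex.norm_real]
  push_cast
  exact this

/-- The difference of kernels is `(y - x)(1 + t²)/((t - x)(t - y))`. It is positive because almost
every `t` lies outside the ball, on the same side of `x` and `y`. -/
theorem realValue_lt_realValue (hD : D.α ≠ 0 ∨ D.ρ ≠ 0) {x₀ δ x y : ℝ}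
    (h0 : D.ρ (Metric.ball x₀ δ) = 0) (hx : x ∈ Metric.ball x₀ δ) (hy : y ∈ Metric.ball x₀ δ)
    (hxy : x < y) : D.realValue x < D.realValue y := by
  have hint : ∀ z ∈ Metric.ball x₀ δ, Integrable (fun t : ℝ ↦ (1 + z * t) / (t - z)) D.ρ := by
    intro z hz
    obtain ⟨ε, hε, hb⟩ := Metric.isOpen_iff.1 Metric.isOpen_ball z hz
    exact D.integrable_kernel hε (measure_mono_null hb h0)
  have hpos : ∀ᵐ t ∂D.ρ, 0 < (1 + y * t) / (t - y) - (1 + x * t) / (t - x) := by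
    filter_upwards [measure_eq_zero_iff_ae_notMem.1 h0] with t ht
    rw [Real.ball_eq_Ioo] at ht hx hy
    have h1 : 0 < (t - x) * (t - y) := by
      rw [Set.mem_Ioo, not_and_or, not_lt, not_lt] at ht
      rcases ht with ht | ht
      · exact mul_pos_of_neg_of_neg (by linarith [hx.1]) (by linarith [hy.1])
      · exact mul_pos (by linarith [hx.2]) (by linarith [hy.2])
    have hx' : t - x ≠ 0 := left_ne_zero_of_mul h1.ne'
    have hy' : t - y ≠ 0 := right_ne_zero_of_mul h1.ne'
    have : (1 + y * t) / (t - y) - (1 + x * t) / (t - x) =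
        (y - x) * (1 + t ^ 2) / ((t - x) * (t - y)) := by
      field_simp
      ring
    rw [this]
    have := sub_pos.2 hxy
    positivity
  have hge : 0 ≤ ∫ t, ((1 + y * t) / (t - y) - (1 + x * t) / (t - x)) ∂D.ρ :=
    integral_nonneg_of_ae (hpos.mono fun t ht ↦ ht.le)
  have hdiff : D.realValue y - D.realValue x = D.α * (y - x) +
      ∫ t, ((1 + y * t) / (t - y) - (1 + x * t) / (t - x)) ∂D.ρ := by
    rw [integral_sub (hint y hy) (hint x hx)]
    simp only [realValue]
    ring
  rw [← sub_pos, hdiff]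
  have hyx := sub_pos.2 hxy
  rcases eq_or_ne D.ρ 0 with hρ | hρ
  · have hα : 0 < D.α := lt_of_le_of_ne D.α_nonneg (Ne.symm (hD.resolve_right (by simp [hρ])))
    have := mul_pos hα hyx
    linarith
  · have hgt : 0 < ∫ t, ((1 + y * t) / (t - y) - (1 + x * t) / (t - x)) ∂D.ρ := by
      refine lt_of_le_of_ne hge fun h ↦ hρ ?_
      have h1 := (integral_eq_zero_iff_of_nonneg_ae (hpos.mono fun t ht ↦ ht.le)
        ((hint y hy).sub (hint x hx))).1 h.symm
      rw [← ae_eq_bot, ← Filter.eventually_false_iff_eq_bot]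
      filter_upwards [hpos, h1] with t ht1 ht2
      exact ht1.ne' ht2
    have := mul_nonneg D.α_nonneg hyx.le
    linarith

/-- By strict monotonicity each ball free of `ρ` contains at most one zero, so the zero set is
locally null. -/
theorem volume_zeros_realValue (hD : D.α ≠ 0 ∨ D.ρ ≠ 0) :
    volume {x : ℝ | x ∉ D.ρ.support ∧ D.realValue x = 0} = 0 := by
  refine measure_null_of_locally_null _ fun x hx ↦ ?_
  obtain ⟨δ, hδ, h0⟩ := D.exists_ball_null hx.1
  refine ⟨_, inter_mem_nhdsWithin _ (Metric.ball_mem_nhds x hδ), ?_⟩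
  refine measure_mono_null (t := {x}) ?_ (by simp)
  rintro y ⟨⟨-, hy0⟩, hyb⟩
  have hxb : x ∈ Metric.ball x δ := Metric.mem_ball_self hδ
  rcases lt_trichotomy x y with h | h | h
  · exact absurd (D.realValue_lt_realValue hD h0 hxb hyb h) (by rw [hx.2, hy0]; exact lt_irrefl _)
  · exact h.symm
  · exact absurd (D.realValue_lt_realValue hD h0 hyb hxb h) (by rw [hx.2, hy0]; exact lt_irrefl _)

end NevanlinnaData

theorem isOpen_gammaSet (f : ℂ → ℂ) : IsOpen (gammaSet f) := by
  refine isOpen_iff_mem_nhds.2 fun x hx ↦ ?_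
  have h1 : (sigmaSet f)ᶜ ∈ 𝓝 x :=
    (nevanlinnaData f).isClosed_sigma.isOpen_compl.mem_nhds hx.1
  have h2 := ((nevanlinnaData f).continuousAt_realValue hx.1).eventually_lt_const hx.2
  filter_upwards [h1, h2] with y hy1 hy2 using ⟨hy1, hy2⟩

/-! ### Components of open subsets of the circle. -/

theorem infty_mem_closure_coe_image {l : Filter ℝ} [l.NeBot] (hl : l ≤ cocompact ℝ) {s : Set ℝ}
    (hs : s ∈ l) : ∞ ∈ closure (((↑) : ℝ → OnePoint ℝ) '' s) := by
  refine mem_closure_of_tendsto (f := ((↑) : ℝ → OnePoint ℝ)) (b := l)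
    (OnePoint.tendsto_coe_infty.mono_left (by rwa [coclosedCompact_eq_cocompact])) ?_
  filter_upwards [hs] with t ht using Set.mem_image_of_mem _ ht

theorem isPreconnected_insert_infty {l : Filter ℝ} [l.NeBot] (hl : l ≤ cocompact ℝ) {s : Set ℝ}
    (hs : s ∈ l) (hc : IsPreconnected s) :
    IsPreconnected (insert ∞ (((↑) : ℝ → OnePoint ℝ) '' s)) :=
  (hc.image _ OnePoint.continuous_coe.continuousOn).subset_closure (Set.subset_insert _ _)
    (Set.insert_subset (infty_mem_closure_coe_image hl hs) subset_closure)

/-- At `∞`, two tails of the line joined at `∞` form a connected neighbourhood. The instance makes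
components of open sets open. -/
instance locallyConnectedSpace_onePoint_real : LocallyConnectedSpace (OnePoint ℝ) := by
  refine locallyConnectedSpace_iff_connected_subsets.2 fun x U hU ↦ ?_
  induction x using OnePoint.rec with
  | infty =>
    obtain ⟨K, ⟨hKc, hK⟩, hKU⟩ := OnePoint.hasBasis_nhds_infty.mem_iff.1 hU
    obtain ⟨R, hR0, hR⟩ := hK.isBounded.exists_pos_norm_le
    refine ⟨insert ∞ (((↑) : ℝ → OnePoint ℝ) '' Set.Ioi R) ∪
      insert ∞ (((↑) : ℝ → OnePoint ℝ) '' Set.Iio (-R)), ?_, ?_, ?_⟩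
    · refine OnePoint.hasBasis_nhds_infty.mem_iff.2
        ⟨Set.Icc (-R) R, ⟨isClosed_Icc, isCompact_Icc⟩, ?_⟩
      rintro _ (⟨t, ht, rfl⟩ | rfl)
      · rw [Set.mem_compl_iff, Set.mem_Icc, not_and_or, not_le, not_le] at ht
        rcases ht with ht | ht
        · exact Or.inr (Or.inr ⟨t, ht, rfl⟩)
        · exact Or.inl (Or.inr ⟨t, ht, rfl⟩)
      · exact Or.inl (Or.inl rfl)
    · exact (isPreconnected_insert_infty atTop_le_cocompact (Ioi_mem_atTop R)
        isPreconnected_Ioi).union ∞ (Set.mem_insert _ _) (Set.mem_insert _ _)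
        (isPreconnected_insert_infty atBot_le_cocompact (Iio_mem_atBot (-R)) isPreconnected_Iio)
    · have hout : ∀ t : ℝ, R < |t| → t ∈ Kᶜ := fun t ht htK ↦ not_lt.2 (hR t htK) ht
      rintro _ ((rfl | ⟨t, ht, rfl⟩) | (rfl | ⟨t, ht, rfl⟩))
      · exact hKU (Or.inr rfl)
      · exact hKU (Or.inl ⟨t, hout t (lt_of_lt_of_le ht (le_abs_self t)), rfl⟩)
      · exact hKU (Or.inr rfl)
      · refine hKU (Or.inl ⟨t, hout t (lt_of_lt_of_le ?_ (neg_le_abs t)), rfl⟩)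
        have : t < -R := ht
        linarith
  | coe x =>
    rw [OnePoint.nhds_coe_eq, mem_map] at hU
    obtain ⟨ε, hε, hb⟩ := Metric.mem_nhds_iff.1 hU
    refine ⟨((↑) : ℝ → OnePoint ℝ) '' Metric.ball x ε, ?_,
      (convex_ball x ε).isPreconnected.image _ OnePoint.continuous_coe.continuousOn,
      Set.image_subset_iff.2 hb⟩
    rw [OnePoint.nhds_coe_eq]
    exact image_mem_map (Metric.ball_mem_nhds x hε)

theorem eq_circleInterval_of_infty_notMem {C : Set (OnePoint ℝ)} (ho : IsOpen C)
    (hc : IsPreconnected C) (hne : C.Nonempty) (hinf : ∞ ∉ C) :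
    ∃ e : OnePoint ℝ × OnePoint ℝ, C = circleInterval e.1 e.2 := by
  set s : Set ℝ := ((↑) : ℝ → OnePoint ℝ) ⁻¹' C with hs
  have hCs : C = ((↑) : ℝ → OnePoint ℝ) '' s := by
    refine (Set.image_preimage_eq_iff.2 ?_).symm
    intro x hx
    exact OnePoint.ne_infty_iff_exists.1 fun h ↦ hinf (h ▸ hx)
  have hso : IsOpen s := ho.preimage OnePoint.continuous_coe
  have hsc : IsPreconnected s := by
    rw [hCs] at hc
    exact (OnePoint.isOpenEmbedding_coe.isInducing.isPreconnected_image).1 hc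
  have hsne : s.Nonempty := by
    rw [hCs] at hne
    exact hne.of_image
  have hsconn : IsConnected s := ⟨hsne, hsc⟩
  by_cases hb : BddBelow s <;> by_cases ha : BddAbove s
  · have h : s = Set.Ioo (sInf s) (sSup s) := by
      refine Set.Subset.antisymm ?_ (hsconn.Ioo_csInf_csSup_subset hb ha)
      rw [← interior_Icc]
      exact interior_maximal (subset_Icc_csInf_csSup hb ha) hso
    have hlt : sInf s < sSup s := by
      rw [h] at hsne
      exact Set.nonempty_Ioo.1 hsne
    refine ⟨((sInf s : ℝ), (sSup s : ℝ)), ?_⟩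
    rw [hCs]
    simp only [circleInterval, if_pos hlt]
    rw [← h]
  · have h : s = Set.Ioi (sInf s) := by
      refine Set.Subset.antisymm ?_ (hsc.Ioi_csInf_subset hb ha)
      rw [← interior_Ici]
      exact interior_maximal (fun x hx ↦ csInf_le hb hx) hso
    refine ⟨((sInf s : ℝ), ∞), ?_⟩
    rw [hCs]
    simp only [circleInterval]
    rw [← h]
  · have h : s = Set.Iio (sSup s) := by
      refine Set.Subset.antisymm ?_ (hsc.Iio_csSup_subset hb ha)
      rw [← interior_Iic]
      exact interior_maximal (fun x hx ↦ le_csSup ha hx) hso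
    refine ⟨(∞, (sSup s : ℝ)), ?_⟩
    rw [hCs]
    simp only [circleInterval]
    rw [← h]
  · refine ⟨(∞, ∞), ?_⟩
    rw [hCs, hsc.eq_univ_of_unbounded hb ha]
    rfl

theorem eq_circleInterval_of_infty_mem {C : Set (OnePoint ℝ)} (ho : IsOpen C)
    (hc : IsPreconnected C) (hinf : ∞ ∈ C) (hC : C ≠ Set.univ) :
    ∃ e : OnePoint ℝ × OnePoint ℝ, C = circleInterval e.1 e.2 := by
  -- The complement is a compact nonempty set of reals; its maximum and minimum are the left and
  -- right endpoints `b ≥ a`. Equality is the circle without one point.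
  set T : Set ℝ := (((↑) : ℝ → OnePoint ℝ) ⁻¹' C)ᶜ with hT
  have hTc : IsCompact T := ((OnePoint.isOpen_iff_of_mem hinf).1 ho).2
  have hTne : T.Nonempty := by
    obtain ⟨x, hx⟩ := (Set.ne_univ_iff_exists_notMem C).1 hC
    induction x using OnePoint.rec with
    | infty => exact absurd hinf hx
    | coe x => exact ⟨x, hx⟩
  have hbT := hTc.sSup_mem hTne
  have haT := hTc.sInf_mem hTne
  have hle : sInf T ≤ sSup T := csInf_le hTc.bddBelow hbT
  refine ⟨((sSup T : ℝ), (sInf T : ℝ)), ?_⟩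
  simp only [circleInterval, if_neg (not_lt.2 hle)]
  ext x
  induction x using OnePoint.rec with
  | infty => simp [hinf]
  | coe x =>
    have hrhs : (x : OnePoint ℝ) ∈ ((↑) : ℝ → OnePoint ℝ) '' Set.Ioi (sSup T) ∪ {∞} ∪
        ((↑) : ℝ → OnePoint ℝ) '' Set.Iio (sInf T) ↔ sSup T < x ∨ x < sInf T := by
      simp
    rw [hrhs]
    constructor
    · intro hx
      by_contra! hcon
      have hxa : sInf T ≠ x := fun h ↦ haT (by rwa [h])
      have hxb : x ≠ sSup T := fun h ↦ hbT (by rwa [← h])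
      -- If `C` met the open interval between the endpoints, that interval and the complement of its
      -- closure would disconnect `C`.
      have hcover : C ⊆ ((↑) : ℝ → OnePoint ℝ) '' Set.Ioo (sInf T) (sSup T) ∪
          (((↑) : ℝ → OnePoint ℝ) '' Set.Icc (sInf T) (sSup T))ᶜ := by
        intro y hy
        by_contra hyn
        rw [Set.mem_union, not_or, Set.mem_compl_iff, not_not] at hyn
        obtain ⟨hy1, t, ht, rfl⟩ := hyn
        refine hy1 ⟨t, ⟨lt_of_le_of_ne ht.1 ?_, lt_of_le_of_ne ht.2 ?_⟩, rfl⟩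
        · intro h
          exact haT (by rwa [h])
        · intro h
          exact hbT (by rwa [← h])
      obtain ⟨y, -, hy1, hy2⟩ := hc _ _ (OnePoint.isOpen_image_coe.2 isOpen_Ioo)
        (OnePoint.isOpen_compl_image_coe.2 ⟨isClosed_Icc, isCompact_Icc⟩) hcover
        ⟨x, hx, x, ⟨lt_of_le_of_ne hcon.2 hxa, lt_of_le_of_ne hcon.1 hxb⟩, rfl⟩
        ⟨∞, hinf, OnePoint.infty_notMem_image_coe⟩
      exact hy2 (Set.image_mono Set.Ioo_subset_Icc_self hy1)
    · intro hx
      by_contra hxC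
      have hxT : x ∈ T := hxC
      rcases hx with hx | hx
      · exact not_le.2 hx (le_csSup hTc.bddAbove hxT)
      · exact not_le.2 hx (csInf_le hTc.bddBelow hxT)

theorem connectedComponentIn_eq_circleInterval {O : Set (OnePoint ℝ)} (ho : IsOpen O)
    (hO : O ≠ Set.univ) {x : OnePoint ℝ} (hx : x ∈ O) :
    ∃ e : OnePoint ℝ × OnePoint ℝ, connectedComponentIn O x = circleInterval e.1 e.2 := by
  have hne : connectedComponentIn O x ≠ Set.univ := fun h ↦
    hO (Set.univ_subset_iff.1 (h ▸ connectedComponentIn_subset O x))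
  by_cases hinf : ∞ ∈ connectedComponentIn O x
  · exact eq_circleInterval_of_infty_mem ho.connectedComponentIn
      isPreconnected_connectedComponentIn hinf hne
  · exact eq_circleInterval_of_infty_notMem ho.connectedComponentIn
      isPreconnected_connectedComponentIn ⟨x, mem_connectedComponentIn hx⟩ hinf

/-- The real points of the interval `(b, a)` of the circle. -/
def circleTrace (e : OnePoint ℝ × OnePoint ℝ) : Set ℝ :=
  {t | (t : OnePoint ℝ) ∈ circleInterval e.1 e.2}

theorem circleTrace_infty_infty : circleTrace (∞, ∞) = Set.univ := by
  ext t
  simp [circleTrace, circleInterval]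

theorem circleTrace_infty_coe (a : ℝ) : circleTrace (∞, (a : OnePoint ℝ)) = Set.Iio a := by
  ext t
  simp [circleTrace, circleInterval]

theorem circleTrace_coe_infty (b : ℝ) : circleTrace ((b : OnePoint ℝ), ∞) = Set.Ioi b := by
  ext t
  simp [circleTrace, circleInterval]

theorem circleTrace_coe_coe_of_lt {a b : ℝ} (h : b < a) :
    circleTrace ((b : OnePoint ℝ), (a : OnePoint ℝ)) = Set.Ioo b a := by
  ext t
  simp [circleTrace, circleInterval, h]

theorem circleTrace_coe_coe_of_le {a b : ℝ} (h : a ≤ b) :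
    circleTrace ((b : OnePoint ℝ), (a : OnePoint ℝ)) = (Set.Icc a b)ᶜ := by
  ext t
  simp only [circleTrace, circleInterval, if_neg (not_lt.2 h)]
  simp [← not_le, imp_iff_not_or, or_comm]

theorem infty_mem_circleInterval_coe_coe {a b : ℝ} :
    ∞ ∈ circleInterval (b : OnePoint ℝ) (a : OnePoint ℝ) ↔ a ≤ b := by
  by_cases h : b < a
  · simp [circleInterval, h]
  · simp [circleInterval, h, not_lt.1 h]

theorem isOpen_circleTrace (e : OnePoint ℝ × OnePoint ℝ) : IsOpen (circleTrace e) := by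
  obtain ⟨b, a⟩ := e
  induction b using OnePoint.rec <;> induction a using OnePoint.rec
  · rw [circleTrace_infty_infty]; exact isOpen_univ
  · rw [circleTrace_infty_coe]; exact isOpen_Iio
  · rw [circleTrace_coe_infty]; exact isOpen_Ioi
  · rename_i b a
    rcases lt_or_ge b a with h | h
    · rw [circleTrace_coe_coe_of_lt h]; exact isOpen_Ioo
    · rw [circleTrace_coe_coe_of_le h]; exact isClosed_Icc.isOpen_compl

theorem circleTrace_nonempty (e : OnePoint ℝ × OnePoint ℝ) : (circleTrace e).Nonempty := by
  obtain ⟨b, a⟩ := e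
  induction b using OnePoint.rec <;> induction a using OnePoint.rec
  · rw [circleTrace_infty_infty]; exact Set.univ_nonempty
  · rw [circleTrace_infty_coe]; exact Set.nonempty_Iio
  · rw [circleTrace_coe_infty]; exact Set.nonempty_Ioi
  · rename_i b a
    rcases lt_or_ge b a with h | h
    · rw [circleTrace_coe_coe_of_lt h]; exact Set.nonempty_Ioo.2 h
    · rw [circleTrace_coe_coe_of_le h]
      exact ⟨b + 1, fun hb ↦ by linarith [hb.2]⟩

open Classical in
/-- The left endpoint of an interval of the circle. -/
noncomputable def leftEndpoint (J : Set (OnePoint ℝ)) : OnePoint ℝ :=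
  if ∞ ∈ J then ((sSup (((↑) : ℝ → OnePoint ℝ) ⁻¹' J)ᶜ : ℝ) : OnePoint ℝ)
  else if BddBelow (((↑) : ℝ → OnePoint ℝ) ⁻¹' J) then
    ((sInf (((↑) : ℝ → OnePoint ℝ) ⁻¹' J) : ℝ) : OnePoint ℝ) else ∞

open Classical in
/-- The right endpoint of an interval of the circle. -/
noncomputable def rightEndpoint (J : Set (OnePoint ℝ)) : OnePoint ℝ :=
  if ∞ ∈ J then ((sInf (((↑) : ℝ → OnePoint ℝ) ⁻¹' J)ᶜ : ℝ) : OnePoint ℝ)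
  else if BddAbove (((↑) : ℝ → OnePoint ℝ) ⁻¹' J) then
    ((sSup (((↑) : ℝ → OnePoint ℝ) ⁻¹' J) : ℝ) : OnePoint ℝ) else ∞

theorem endpoints_circleInterval (e : OnePoint ℝ × OnePoint ℝ) :
    leftEndpoint (circleInterval e.1 e.2) = e.1 ∧
      rightEndpoint (circleInterval e.1 e.2) = e.2 := by
  have htr : ((↑) : ℝ → OnePoint ℝ) ⁻¹' (circleInterval e.1 e.2) = circleTrace e := rfl
  rw [leftEndpoint, rightEndpoint, htr]
  obtain ⟨b, a⟩ := e
  induction b using OnePoint.rec <;> induction a using OnePoint.rec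
  · have : ∞ ∉ circleInterval ∞ ∞ := OnePoint.infty_notMem_image_coe
    simp [this, circleTrace_infty_infty]
  · rename_i a
    have : ∞ ∉ circleInterval ∞ (a : OnePoint ℝ) := OnePoint.infty_notMem_image_coe
    simp [this, circleTrace_infty_coe, bddAbove_Iio, not_bddBelow_Iio]
  · rename_i b
    have : ∞ ∉ circleInterval (b : OnePoint ℝ) ∞ := OnePoint.infty_notMem_image_coe
    simp [this, circleTrace_coe_infty, bddBelow_Ioi, not_bddAbove_Ioi]
  · rename_i b a
    rcases lt_or_ge b a with h | h
    · simp [infty_mem_circleInterval_coe_coe, not_le.2 h, circleTrace_coe_coe_of_lt h,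
        bddBelow_Ioo, bddAbove_Ioo, csInf_Ioo h, csSup_Ioo h]
    · simp [infty_mem_circleInterval_coe_coe, h, circleTrace_coe_coe_of_le h, csInf_Icc h,
        csSup_Icc h]

/-- Endpoints can be read off from the set, so indexing by pairs counts each component, and hence
each factor, exactly once. -/
theorem eq_of_circleInterval_eq {e e' : OnePoint ℝ × OnePoint ℝ}
    (h : circleInterval e.1 e.2 = circleInterval e'.1 e'.2) : e = e' := by
  have h1 := endpoints_circleInterval e
  have h2 := endpoints_circleInterval e'
  rw [h] at h1
  exact Prod.ext (h1.1.symm.trans h2.1) (h1.2.symm.trans h2.2)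

theorem pairwise_disjoint_circleTrace (O : Set (OnePoint ℝ)) :
    Pairwise (Function.onFun Disjoint fun e : componentIntervals O ↦ circleTrace e.1) := by
  rintro ⟨e, x, hx, hxe⟩ ⟨e', x', hx', hxe'⟩ hne
  refine Set.disjoint_left.2 fun t ht ht' ↦ hne (Subtype.ext (eq_of_circleInterval_eq ?_))
  have h1 : (t : OnePoint ℝ) ∈ connectedComponentIn O x := by rw [hxe]; exact ht
  have h2 : (t : OnePoint ℝ) ∈ connectedComponentIn O x' := by rw [hxe']; exact ht'
  rw [← hxe, ← hxe', connectedComponentIn_eq h1, connectedComponentIn_eq h2]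

/-- Disjoint nonempty open subsets of a separable space are countably many. -/
theorem countable_componentIntervals (O : Set (OnePoint ℝ)) : Countable (componentIntervals O) :=
  (pairwise_disjoint_circleTrace O).countable_of_isOpen_disjoint
    (fun e ↦ isOpen_circleTrace e.1) fun e ↦ circleTrace_nonempty e.1

theorem iUnion_circleTrace {O : Set (OnePoint ℝ)} (ho : IsOpen O) (hO : O ≠ Set.univ) :
    ⋃ e : componentIntervals O, circleTrace e.1 = {t : ℝ | (t : OnePoint ℝ) ∈ O} := by
  ext t
  simp only [Set.mem_iUnion, Set.mem_ofPred_eq]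
  constructor
  · rintro ⟨⟨e, x, hx, hxe⟩, ht⟩
    refine connectedComponentIn_subset O x ?_
    rw [hxe]
    exact ht
  · intro ht
    obtain ⟨e, he⟩ := connectedComponentIn_eq_circleInterval ho hO ht
    refine ⟨⟨e, t, ht, he⟩, ?_⟩
    change (t : OnePoint ℝ) ∈ circleInterval e.1 e.2
    rw [← he]
    exact mem_connectedComponentIn ht

/-! ### The Kreĭn factors and their exponential form. -/

theorem sub_ofReal_ne_zero {w : ℂ} (hw : w ∈ upperHalf) (a : ℝ) : w - a ≠ 0 := by
  intro h
  have h1 : 0 < w.im := hw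
  have := congrArg Complex.im h
  simp at this
  linarith

theorem norm_I_sub_ofReal_pos (a : ℝ) : 0 < ‖Complex.I - (a : ℂ)‖ :=
  norm_pos_iff.2 (sub_ofReal_ne_zero I_mem_upperHalf a)

/-- The boundary values on the line of the factor of the interval `(b, a)`. -/
noncomputable def kreinBoundary (e : OnePoint ℝ × OnePoint ℝ) (t : ℝ) : ℝ :=
  (kreinFactor e.1 e.2 t).re

/-- For real endpoints, `Im ((w - a)/(w - b)) = (a - b) Im w / |w - b|²`, and the sign in the factor
is chosen to match that of `a - b`. For `a = b` the factor reduces to `-1`. -/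
theorem ne_zero_and_im_nonneg_kreinFactor (e : OnePoint ℝ × OnePoint ℝ) {w : ℂ}
    (hw : w ∈ upperHalf) : kreinFactor e.1 e.2 w ≠ 0 ∧ 0 ≤ (kreinFactor e.1 e.2 w).im := by
  have hwim : 0 < w.im := hw
  have hmob : ∀ a b : ℝ, ((w - a) / (w - b)).im = (a - b) * w.im / Complex.normSq (w - b) := by
    intro a b
    rw [Complex.div_im]
    simp
    ring
  have hsq : ∀ b : ℝ, 0 < Complex.normSq (w - b) := fun b ↦
    Complex.normSq_pos.2 (sub_ofReal_ne_zero hw b)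
  obtain ⟨b, a⟩ := e
  induction b using OnePoint.rec <;> induction a using OnePoint.rec
  · simp [kreinFactor]
  · rename_i a
    have ha := norm_I_sub_ofReal_pos a
    refine ⟨div_ne_zero (sub_ofReal_ne_zero hw a) (by exact_mod_cast ha.ne'), ?_⟩
    simp only [kreinFactor]
    rw [Complex.div_ofReal_im]
    simp only [Complex.sub_im, Complex.ofReal_im, sub_zero]
    positivity
  · rename_i b
    have hb := norm_I_sub_ofReal_pos b
    have hb' : (‖Complex.I - (b : ℂ)‖ : ℂ) ≠ 0 := by exact_mod_cast hb.ne'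
    refine ⟨neg_ne_zero.2 (div_ne_zero hb' (sub_ofReal_ne_zero hw b)), ?_⟩
    have := hsq b
    simp only [kreinFactor]
    rw [Complex.neg_im, Complex.div_im]
    simp only [Complex.ofReal_im, Complex.ofReal_re, Complex.sub_im, sub_zero, zero_mul, zero_div,
      zero_sub, neg_neg]
    positivity
  · rename_i b a
    have ha := norm_I_sub_ofReal_pos a
    have hb := norm_I_sub_ofReal_pos b
    have hC : (‖Complex.I - (b : ℂ)‖ : ℂ) / (‖Complex.I - (a : ℂ)‖ : ℂ) =
        ((‖Complex.I - (b : ℂ)‖ / ‖Complex.I - (a : ℂ)‖ : ℝ) : ℂ) := by push_cast; rfl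
    have hCpos : 0 < ‖Complex.I - (b : ℂ)‖ / ‖Complex.I - (a : ℂ)‖ := div_pos hb ha
    have hne : (((‖Complex.I - (b : ℂ)‖ / ‖Complex.I - (a : ℂ)‖ : ℝ) : ℂ)) *
        ((w - a) / (w - b)) ≠ 0 :=
      mul_ne_zero (Complex.ofReal_ne_zero.2 hCpos.ne')
        (div_ne_zero (sub_ofReal_ne_zero hw a) (sub_ofReal_ne_zero hw b))
    have := hsq b
    rcases lt_or_ge b a with h | h
    · simp only [kreinFactor, if_pos h, hC]
      refine ⟨hne, ?_⟩
      rw [Complex.im_ofReal_mul, hmob]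
      have := sub_pos.2 h
      positivity
    · simp only [kreinFactor, if_neg (not_lt.2 h), hC]
      refine ⟨neg_ne_zero.2 hne, ?_⟩
      rw [Complex.neg_im, Complex.im_ofReal_mul, hmob, ← mul_neg, ← neg_div, ← neg_mul, neg_sub]
      have := sub_nonneg.2 h
      positivity

theorem differentiableAt_kreinFactor (e : OnePoint ℝ × OnePoint ℝ) {w : ℂ}
    (hw : e.1 ≠ ∞ → ∀ b : ℝ, e.1 = b → w - b ≠ 0) :
    DifferentiableAt ℂ (kreinFactor e.1 e.2) w := by
  obtain ⟨b, a⟩ := e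
  induction b using OnePoint.rec <;> induction a using OnePoint.rec
  · exact differentiableAt_const _
  · unfold kreinFactor
    fun_prop
  · rename_i b
    have := hw (OnePoint.coe_ne_infty b) b rfl
    unfold kreinFactor
    fun_prop (disch := assumption)
  · rename_i b a
    have := hw (OnePoint.coe_ne_infty b) b rfl
    have h1 : DifferentiableAt ℂ (fun w : ℂ ↦ (‖Complex.I - b‖ : ℂ) / (‖Complex.I - a‖ : ℂ) *
        ((w - a) / (w - b))) w := by
      fun_prop (disch := assumption)
    rcases lt_or_ge b a with h | h
    · exact h1.congr_of_eventuallyEq (Eventually.of_forall fun z ↦ by simp [kreinFactor, h])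
    · exact h1.neg.congr_of_eventuallyEq
        (Eventually.of_forall fun z ↦ by simp [kreinFactor, not_lt.2 h])

theorem classH_kreinFactor (e : OnePoint ℝ × OnePoint ℝ) : ClassH (kreinFactor e.1 e.2) :=
  ⟨fun _ hw ↦ (differentiableAt_kreinFactor e
    fun _ b _ ↦ sub_ofReal_ne_zero hw b).differentiableWithinAt,
    fun _ hw ↦ (ne_zero_and_im_nonneg_kreinFactor e hw).2⟩

theorem norm_kreinFactor_I (e : OnePoint ℝ × OnePoint ℝ) : ‖kreinFactor e.1 e.2 Complex.I‖ = 1 := by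
  obtain ⟨b, a⟩ := e
  induction b using OnePoint.rec <;> induction a using OnePoint.rec
  · simp [kreinFactor]
  · rename_i a
    simp [kreinFactor, (norm_I_sub_ofReal_pos a).ne']
  · rename_i b
    simp [kreinFactor, (norm_I_sub_ofReal_pos b).ne']
  · rename_i b a
    have ha := (norm_I_sub_ofReal_pos a).ne'
    have hb := (norm_I_sub_ofReal_pos b).ne'
    have h1 : ‖(‖Complex.I - b‖ : ℂ) / (‖Complex.I - a‖ : ℂ) *
        ((Complex.I - a) / (Complex.I - b))‖ = 1 := by
      rw [norm_mul, norm_div, norm_div, Complex.norm_real, Complex.norm_real, norm_norm, norm_norm]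
      field_simp
    rcases lt_or_ge b a with h | h
    · simpa only [kreinFactor, if_pos h] using h1
    · simpa only [kreinFactor, if_neg (not_lt.2 h), norm_neg] using h1

theorem kreinFactor_ofReal (e : OnePoint ℝ × OnePoint ℝ) (t : ℝ) :
    kreinFactor e.1 e.2 t = (kreinBoundary e t : ℂ) := by
  refine Complex.ext rfl ?_
  rw [Complex.ofReal_im]
  obtain ⟨b, a⟩ := e
  induction b using OnePoint.rec <;> induction a using OnePoint.rec
  · simp [kreinFactor]
  · simp only [kreinFactor]
    norm_cast
  · simp only [kreinFactor]
    norm_cast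
  · simp only [kreinFactor]
    split_ifs <;> norm_cast

/-- Only the finite endpoints are exceptional: the factor vanishes at `a`, has a pole at `b`, and is
real with the stated sign elsewhere. -/
theorem kreinBoundary_sign (e : OnePoint ℝ × OnePoint ℝ) :
    ∀ᵐ t : ℝ, (e.1 ≠ ∞ → ∀ b : ℝ, e.1 = b → (t : ℂ) - b ≠ 0) ∧
      (t ∈ circleTrace e → kreinBoundary e t < 0) ∧ (t ∉ circleTrace e → 0 < kreinBoundary e t) := by
  have hne : ∀ a : ℝ, ∀ᵐ t : ℝ, t ≠ a := fun a ↦ by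
    simp [ae_iff]
  have hcast : ∀ e t (x : ℝ), kreinFactor e.1 e.2 (t : ℝ) = (x : ℂ) → kreinBoundary e t = x := by
    intro e t x h
    rw [kreinBoundary, h, Complex.ofReal_re]
  obtain ⟨b, a⟩ := e
  induction b using OnePoint.rec <;> induction a using OnePoint.rec
  · refine ae_of_all _ fun t ↦ ⟨fun h ↦ absurd rfl h, ?_⟩
    rw [circleTrace_infty_infty]
    simp [kreinBoundary, kreinFactor]
  · rename_i a
    filter_upwards [hne a] with t ht
    refine ⟨fun h ↦ absurd rfl h, ?_⟩
    have ha := norm_I_sub_ofReal_pos a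
    rw [circleTrace_infty_coe, hcast _ t ((t - a) / ‖Complex.I - a‖) (by simp [kreinFactor])]
    refine ⟨fun h ↦ div_neg_of_neg_of_pos (sub_neg.2 h) ha, fun h ↦ div_pos (sub_pos.2 ?_) ha⟩
    exact lt_of_le_of_ne (not_lt.1 h) ht.symm
  · rename_i b
    filter_upwards [hne b] with t ht
    have hb := norm_I_sub_ofReal_pos b
    refine ⟨fun _ b' hb' ↦ ?_, ?_⟩
    · rw [← OnePoint.coe_injective hb', sub_ne_zero]
      exact_mod_cast ht
    rw [circleTrace_coe_infty, hcast _ t (-(‖Complex.I - b‖ / (t - b))) (by simp [kreinFactor])]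
    refine ⟨fun h ↦ neg_neg_of_pos (div_pos hb (sub_pos.2 h)), fun h ↦
      neg_pos.2 (div_neg_of_pos_of_neg hb (sub_neg.2 ?_))⟩
    exact lt_of_le_of_ne (not_lt.1 h) ht
  · rename_i b a
    filter_upwards [hne a, hne b] with t hta htb
    have hC := div_pos (norm_I_sub_ofReal_pos b) (norm_I_sub_ofReal_pos a)
    refine ⟨fun _ b' hb' ↦ ?_, ?_⟩
    · rw [← OnePoint.coe_injective hb', sub_ne_zero]
      exact_mod_cast htb
    rcases lt_or_ge b a with h | h
    · rw [circleTrace_coe_coe_of_lt h, hcast _ t (‖Complex.I - b‖ / ‖Complex.I - a‖ *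
        ((t - a) / (t - b))) (by simp [kreinFactor, h])]
      refine ⟨fun ht ↦ mul_neg_of_pos_of_neg hC
        (div_neg_of_neg_of_pos (sub_neg.2 ht.2) (sub_pos.2 ht.1)), fun ht ↦ mul_pos hC ?_⟩
      rw [Set.mem_Ioo, not_and_or, not_lt, not_lt] at ht
      rcases ht with ht | ht
      · have := lt_of_le_of_ne ht htb
        exact div_pos_of_neg_of_neg (by linarith) (by linarith)
      · have := lt_of_le_of_ne ht hta.symm
        exact div_pos (by linarith) (by linarith)
    · rw [circleTrace_coe_coe_of_le h, hcast _ t (-(‖Complex.I - b‖ / ‖Complex.I - a‖ *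
        ((t - a) / (t - b)))) (by simp [kreinFactor, not_lt.2 h])]
      refine ⟨fun ht ↦ neg_neg_of_pos (mul_pos hC ?_), fun ht ↦
        neg_pos.2 (mul_neg_of_pos_of_neg hC ?_)⟩
      · rw [Set.mem_compl_iff, Set.mem_Icc, not_and_or, not_le, not_le] at ht
        rcases ht with ht | ht
        · exact div_pos_of_neg_of_neg (by linarith) (by linarith)
        · exact div_pos (by linarith) (by linarith)
      · rw [Set.mem_compl_iff, not_not] at ht
        exact div_neg_of_pos_of_neg (sub_pos.2 (lt_of_le_of_ne ht.1 hta.symm))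
          (sub_neg.2 (lt_of_le_of_ne ht.2 htb))

/-- The general exponential representation, with set of negativity the trace of `J`; the
normalization at `i` removes the constant. -/
theorem kreinFactor_eq_exp (e : OnePoint ℝ × OnePoint ℝ) {w : ℂ} (hw : w ∈ upperHalf) :
    kreinFactor e.1 e.2 w = Complex.exp (Real.pi *
      ∫ t in circleTrace e, (1 + w * (t : ℂ)) / ((t : ℂ) - w) ∂cauchyMeasure) := by
  have h := (classH_kreinFactor e).eq_norm_mul_exp
    (fun z hz ↦ (ne_zero_and_im_nonneg_kreinFactor e hz).1)
    (isOpen_circleTrace e).measurableSet (v := kreinBoundary e) ?_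
    ((kreinBoundary_sign e).mono fun t ht ↦ ht.2.1)
    ((kreinBoundary_sign e).mono fun t ht ↦ ht.2.2) hw
  · rwa [norm_kreinFactor_I, Complex.ofReal_one, one_mul] at h
  · filter_upwards [kreinBoundary_sign e] with t ht
    rw [← kreinFactor_ofReal]
    exact (differentiableAt_kreinFactor e ht.1).continuousAt.tendsto.mono_left nhdsWithin_le_nhds

/-! ### Exponential form of `f` in terms of `Γ(f)`. -/

/-- By the open mapping theorem a nonconstant `f` with a zero would take values `-iε/2`, below the
real line. -/
theorem ClassH.ne_zero {f : ℂ → ℂ} (hf : ClassH f) (hf0 : ∃ z ∈ upperHalf, f z ≠ 0) :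
    ∀ z ∈ upperHalf, f z ≠ 0 := by
  intro z hz h0
  rcases (hf.1.analyticOnNhd isOpen_upperHalf).is_constant_or_isOpen
    convex_upperHalf.isPreconnected with ⟨c, hc⟩ | ho
  · obtain ⟨z', hz', hne⟩ := hf0
    exact hne (by rw [hc z' hz', ← hc z hz, h0])
  · have himg : f '' upperHalf ∈ 𝓝 (0 : ℂ) :=
      (ho _ subset_rfl isOpen_upperHalf).mem_nhds ⟨z, hz, h0⟩
    obtain ⟨ε, hε, hb⟩ := Metric.mem_nhds_iff.1 himg
    have hmem : (-(ε / 2 : ℝ) : ℂ) * Complex.I ∈ Metric.ball (0 : ℂ) ε := by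
      rw [mem_ball_zero_iff, norm_mul, norm_neg, Complex.norm_real, Complex.norm_I,
        Real.norm_eq_abs, abs_of_pos (half_pos hε), mul_one]
      exact half_lt_self hε
    obtain ⟨y, hy, hyf⟩ := hb hmem
    have him := hf.2 y hy
    rw [hyf] at him
    simp at him
    linarith

theorem ClassH.nevanlinnaData_represents {f : ℂ → ℂ} (hf : ClassH f) :
    (nevanlinnaData f).Represents f := by
  rw [nevanlinnaData, dif_pos hf.exists_represents]
  exact hf.exists_represents.choose_spec

theorem NevanlinnaData.Represents.tendsto {D : NevanlinnaData} {f : ℂ → ℂ} (hD : D.Represents f)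
    {t : ℝ} (ht : t ∉ D.ρ.support) :
    Tendsto f (𝓝[upperHalf] (t : ℂ)) (𝓝 (D.realValue t : ℂ)) := by
  rw [← D.eval_ofReal]
  refine ((D.continuousAt_eval ht).tendsto.mono_left nhdsWithin_le_nhds).congr' ?_
  filter_upwards [self_mem_nhdsWithin] with z hz using (hD z hz).symm

theorem NevanlinnaData.Represents.ae_realValue_ne_zero {D : NevanlinnaData} {f : ℂ → ℂ}
    (hD : D.Represents f) (hf0 : ∃ z ∈ upperHalf, f z ≠ 0) (hσ : volume D.ρ.support = 0) :
    ∀ᵐ t : ℝ, D.realValue t ≠ 0 := by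
  by_cases hne : D.α ≠ 0 ∨ D.ρ ≠ 0
  · filter_upwards [measure_eq_zero_iff_ae_notMem.1 hσ,
      measure_eq_zero_iff_ae_notMem.1 (D.volume_zeros_realValue hne)] with t h1 h2 h3
    exact h2 ⟨h1, h3⟩
  · rw [not_or, not_not, not_not] at hne
    obtain ⟨z, hz, hfz⟩ := hf0
    rw [hD z hz, hne.1, hne.2] at hfz
    simp only [Complex.ofReal_zero, zero_mul, zero_add, integral_zero_measure, add_zero] at hfz
    refine ae_of_all _ fun t ↦ ?_
    simp only [realValue, hne.1, hne.2, zero_mul, zero_add, integral_zero_measure, add_zero]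
    exact_mod_cast hfz

/-- Off a null set every real point lies in `Ω(f)` and has nonzero boundary value; if it is not in
`Γ(f)`, the value is therefore positive. -/
theorem ClassH.eq_norm_mul_exp_gammaSet {f : ℂ → ℂ} (hf : ClassH f)
    (hf0 : ∃ z ∈ upperHalf, f z ≠ 0) (hσ : volume {x : ℝ | (x : OnePoint ℝ) ∈ sigmaSet f} = 0)
    {w : ℂ} (hw : w ∈ upperHalf) :
    f w = (‖f Complex.I‖ : ℂ) * Complex.exp (Real.pi *
      ∫ t in {t : ℝ | (t : OnePoint ℝ) ∈ gammaSet f},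
        (1 + w * (t : ℂ)) / ((t : ℂ) - w) ∂cauchyMeasure) := by
  have hD := hf.nevanlinnaData_represents
  have hset : {x : ℝ | (x : OnePoint ℝ) ∈ sigmaSet f} = (nevanlinnaData f).ρ.support := by
    ext x
    exact (nevanlinnaData f).coe_mem_sigma_iff
  rw [hset] at hσ
  have hae := measure_eq_zero_iff_ae_notMem.1 hσ
  refine hf.eq_norm_mul_exp (hf.ne_zero hf0)
    ((isOpen_gammaSet f).preimage OnePoint.continuous_coe).measurableSet
    (v := fun t ↦ (nevanlinnaData f).realValue t) ?_ (ae_of_all _ fun t ht ↦ ht.2) ?_ hw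
  · filter_upwards [hae] with t ht using hD.tendsto ht
  · filter_upwards [hae, hD.ae_realValue_ne_zero hf0 hσ] with t ht1 ht2 ht3
    refine lt_of_le_of_ne (not_lt.1 fun h ↦ ht3 ⟨?_, h⟩) ht2.symm
    exact fun h ↦ ht1 ((nevanlinnaData f).coe_mem_sigma_iff.1 h)

/-! ### Convergence and evaluation of the Kreĭn product. -/

theorem norm_kernel_le_of_mem_upperHalf {w : ℂ} {δ M : ℝ} (hδ : 0 < δ) (h : δ ≤ w.im)
    (hM : ‖w‖ ≤ M) (t : ℝ) : ‖(1 + w * (t : ℂ)) / ((t : ℂ) - w)‖ ≤ M + (1 + M ^ 2) / δ := by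
  refine norm_nevanlinna_kernel_le hδ ?_ hM
  have := Complex.abs_im_le_norm ((t : ℂ) - w)
  simp only [Complex.sub_im, Complex.ofReal_im, zero_sub, abs_neg] at this
  exact (h.trans (le_abs_self _)).trans this

theorem exists_norm_kernel_le {K : Set ℂ} (hK : IsCompact K) (hKu : K ⊆ upperHalf) :
    ∃ B, 0 ≤ B ∧ ∀ w ∈ K, ∀ t : ℝ, ‖(1 + w * (t : ℂ)) / ((t : ℂ) - w)‖ ≤ B := by
  rcases K.eq_empty_or_nonempty with rfl | hne
  · exact ⟨0, le_rfl, by simp⟩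
  obtain ⟨w₀, hw₀, hmin⟩ := hK.exists_isMinOn hne Complex.continuous_im.continuousOn
  obtain ⟨M, hM0, hM⟩ := hK.isBounded.exists_pos_norm_le
  have hδ : 0 < w₀.im := hKu hw₀
  exact ⟨M + (1 + M ^ 2) / w₀.im, by positivity, fun w hw t ↦
    norm_kernel_le_of_mem_upperHalf hδ (hmin hw) (hM w hw) t⟩

theorem integrable_kernel_cauchyMeasure {w : ℂ} (hw : w ∈ upperHalf) :
    Integrable (fun t : ℝ ↦ (1 + w * (t : ℂ)) / ((t : ℂ) - w)) cauchyMeasure :=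
  .of_bound (Measurable.aestronglyMeasurable (by fun_prop)) _
    (ae_of_all _ (norm_kernel_le_of_mem_upperHalf hw le_rfl le_rfl))

/-- The factor is `exp L` with `|L| ≤ πB μ(J)`, and `|exp L - 1| ≤ |L| exp |L|`. The constant in
front of `μ(J)` does not depend on `J`. -/
theorem norm_kreinFactor_sub_one_le (e : OnePoint ℝ × OnePoint ℝ) {w : ℂ} (hw : w ∈ upperHalf)
    {B : ℝ} (hB0 : 0 ≤ B) (hB : ∀ t : ℝ, ‖(1 + w * (t : ℂ)) / ((t : ℂ) - w)‖ ≤ B) :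
    ‖kreinFactor e.1 e.2 w - 1‖ ≤ Real.pi * B * Real.exp (Real.pi * B *
      cauchyMeasure.real Set.univ) * cauchyMeasure.real (circleTrace e) := by
  set L : ℂ := Real.pi * ∫ t in circleTrace e, (1 + w * (t : ℂ)) / ((t : ℂ) - w) ∂cauchyMeasure
    with hL
  have h1 : ‖L‖ ≤ Real.pi * B * cauchyMeasure.real (circleTrace e) := by
    rw [hL, norm_mul, Complex.norm_real, Real.norm_eq_abs, abs_of_pos Real.pi_pos, mul_assoc]
    gcongr
    exact norm_setIntegral_le_of_norm_le_const (measure_lt_top _ _) fun t _ ↦ hB t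
  have h2 : cauchyMeasure.real (circleTrace e) ≤ cauchyMeasure.real Set.univ :=
    measureReal_mono (Set.subset_univ _)
  have h3 : ‖Complex.exp L - 1‖ ≤ ‖L‖ * Real.exp ‖L‖ := by
    simpa using Complex.norm_exp_sub_sum_le_norm_mul_exp L 1
  rw [kreinFactor_eq_exp e hw, ← hL]
  calc ‖Complex.exp L - 1‖ ≤ ‖L‖ * Real.exp ‖L‖ := h3
    _ ≤ (Real.pi * B * cauchyMeasure.real (circleTrace e)) *
        Real.exp (Real.pi * B * cauchyMeasure.real Set.univ) := by
      have h4 : ‖L‖ ≤ Real.pi * B * cauchyMeasure.real Set.univ := h1.trans (by gcongr)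
      gcongr
    _ = _ := by ring

/-- The traces are disjoint, so the sum is the measure of their union, which is finite. -/
theorem summable_cauchyMeasure_circleTrace (O : Set (OnePoint ℝ)) :
    Summable fun e : componentIntervals O ↦ cauchyMeasure.real (circleTrace e.1) := by
  have := countable_componentIntervals O
  refine ENNReal.summable_toReal ?_
  rw [← measure_iUnion (pairwise_disjoint_circleTrace O)
    fun e ↦ (isOpen_circleTrace e.1).measurableSet]
  exact measure_ne_top _ _

theorem multipliableLocallyUniformlyOn_kreinFactor (O : Set (OnePoint ℝ)) :
    MultipliableLocallyUniformlyOn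
      (fun (e : componentIntervals O) (z : ℂ) ↦ kreinFactor e.1.1 e.1.2 z) upperHalf := by
  refine ⟨_, hasProdLocallyUniformlyOn_of_forall_compact isOpen_upperHalf
    (g := fun z ↦ ∏' e : componentIntervals O, (1 + (kreinFactor e.1.1 e.1.2 z - 1)))
    fun K hKu hK ↦ ?_⟩
  obtain ⟨B, hB0, hB⟩ := exists_norm_kernel_le hK hKu
  have h := Summable.hasProdUniformlyOn_one_add hK
    (f := fun (e : componentIntervals O) z ↦ kreinFactor e.1.1 e.1.2 z - 1)
    ((summable_cauchyMeasure_circleTrace O).mul_left _)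
    (Eventually.of_forall fun e w hw ↦ norm_kreinFactor_sub_one_le e.1 (hKu hw) hB0 (hB w hw))
    fun e ↦ ((classH_kreinFactor e.1).1.continuousOn.mono hKu).sub continuousOn_const
  simpa only [add_sub_cancel] using h

theorem kreinProduct_eq_exp {O : Set (OnePoint ℝ)} (ho : IsOpen O) {w : ℂ} (hw : w ∈ upperHalf) :
    kreinProduct O w = Complex.exp (Real.pi * ∫ t in {t : ℝ | (t : OnePoint ℝ) ∈ O},
      (1 + w * (t : ℂ)) / ((t : ℂ) - w) ∂cauchyMeasure) := by
  by_cases hO : O = Set.univ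
  · rw [kreinProduct, if_pos hO]
    -- The whole circle and the circle without `∞` have the same real trace, and the factor of the
    -- latter is `-1`.
    have h := kreinFactor_eq_exp (∞, ∞) hw
    have hset : {t : ℝ | (t : OnePoint ℝ) ∈ O} = circleTrace (∞, ∞) := by
      rw [circleTrace_infty_infty, hO]
      simp
    rw [hset, ← h]
    rfl
  · have := countable_componentIntervals O
    rw [kreinProduct, if_neg hO, ← iUnion_circleTrace ho hO]
    have h := (hasSum_integral_iUnion
      (fun e : componentIntervals O ↦ (isOpen_circleTrace e.1).measurableSet)
      (pairwise_disjoint_circleTrace O)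
      (integrable_kernel_cauchyMeasure hw).integrableOn).mul_left (Real.pi : ℂ)
    -- The exponential turns the unconditional sum of integrals over the components into an
    -- unconditional product of the factors.
    refine HasProd.tprod_eq ?_
    simpa only [Function.comp_def, ← kreinFactor_eq_exp _ hw] using h.cexp

theorem mainTheorem2 (f : ℂ → ℂ) (hf : ClassH f) (hf0 : ∃ z ∈ upperHalf, f z ≠ 0)
    (hσ : MeasureTheory.volume {x : ℝ | (x : OnePoint ℝ) ∈ sigmaSet f} = 0) :
    IsOpen (gammaSet f) ∧
    MultipliableLocallyUniformlyOn
      (fun (e : componentIntervals (gammaSet f)) (z : ℂ) => kreinFactor e.1.1 e.1.2 z)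
      upperHalf ∧
    ∃ c : ℝ, 0 < c ∧ ∀ z ∈ upperHalf, f z = (c : ℂ) * kreinProduct (gammaSet f) z := by
  refine ⟨isOpen_gammaSet f, multipliableLocallyUniformlyOn_kreinFactor _, ‖f Complex.I‖,
    norm_pos_iff.2 (hf.ne_zero hf0 _ I_mem_upperHalf), fun z hz ↦ ?_⟩
  rw [kreinProduct_eq_exp (isOpen_gammaSet f) hz]
  exact hf.eq_norm_mul_exp_gammaSet hf0 hσ hz
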